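/- For $\theta>0$ and $n\ge 1$ let $R_{\theta,n}$ be the $n\times n$ matrix with entries $(R_{\theta,n})_{i,j}=(1+\theta|i-j|/n)\,e^{-\theta|i-j|/n}$, $1\le i,j\le n$. Put $w=\theta/n$, $u=e^{-w}$ and $$\tau_{-1}=(w-1)u+(1+w)u^3,\qquad \tau_0=1-2(1+w)u^2+(1+2w)u^4,\qquad \tau_1^*=(1+w)u-(1+w)(1+2w)u^3,$$ $$\hat\tau_{-2}=2\tau_{-1}u,\quad \hat\tau_{-1}=(1+w)u-3(1+w)u^3+2(1+2w)u^5,\quad \hat\tau_0=1-3(1+2w)u^4+2(1+3w)u^6,$$ $$\tilde\tau_{-2}=\tfrac12\tau_{-1}u,\qquad \tilde\tau_{-1}=\tfrac12\{(2w-1)u+(1+2w)u^5\},$$ $$a=1-2u^2+u^4-2u^2w+2u^4w,\qquad b=2u^2-u^4+w-u^4w-1,$$ $$\tilde a=1-u^2-2u^2w-u^2w^2,\qquad \tilde b=u^2+w+u^2w-1,$$ $$\alpha_{1},\alpha_2=\frac{-(a-2\tau_{-1}u)\mp\sqrt{(a-2\tau_{-1}u)^2-4\tau_{-1}u(b+\tau_{-1}u)}}{2(b+\tau_{-1}u)}$$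 (minus sign for $\alpha_1$, plus sign for $\alpha_2$). For $k=1,2$ write $d_k=(b+\tau_{-1}u)\alpha_k-\tau_{-1}u$, $\rho_k=-(b+\tau_{-1}u)\alpha_k$, $\gamma_k=\tilde a\alpha_k+u^2\tilde b$, and $$C_{3,k}=\hat\tau_{-1}+\frac{\hat\tau_{-2}u[w(1-4u^2+3u^4)+(1-u^2)^2]}{d_k}+\frac{w\tau_{-1}u^2\hat\tau_{-2}(1-u^2)^2}{d_k^2},$$ $$\begin{aligned}C_{6,k}={}&\hat\tau_{-1}\tilde\tau_{-1}-\hat\tau_0\tilde\tau_{-2}+\frac{\hat\tau_{-2}u\tilde\tau_{-1}[w(1-4u^2+3u^4)+(1-u^2)^2]}{d_k}\\&-\frac{\hat\tau_{-2}\tilde\tau_{-2}u^2[w(2-6u^2+4u^4)+(1-u^2)^2]}{d_k}+\frac{w\tau_{-1}u^2\hat\tau_{-2}(\tilde\tau_{-1}-u\tilde\tau_{-2})(1-u^2)^2}{d_k^2},\end{aligned}$$ $$C_{7,k}=\frac{\hat\tau_{-2}u^2[w(2-6u^2+4u^4)+(1-u^2)^2]}{d_k}+\frac{w\tau_{-1}\hat\tau_{-2}u^3(1-u^2)^2}{d_k^2}+\hat\tau_0,$$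 and $\kappa=\tilde\tau_{-2}[(1+2w)^2u^4-1]+\tilde\tau_{-1}\tau_1^*$. **Theorem 6.** Let $0<\beta_0<\beta_1<\infty$, and let $r=(2-\sqrt3)/(2+\sqrt3)$. There are constants $C$ and $N$, depending only on $\beta_0,\beta_1$, such that for all $n\ge\max(N,5)$, all $\theta\in[\beta_0,\beta_1]$ and all $3\le i\le n-2$, the matrix $R_{\theta,n}$ is invertible and the following hold, where each $O(r^n)$ stands for a (possibly different) real number of absolute value at most $Cr^n$: $$\begin{aligned} (R_{\theta,n}^{-1})_{2,n-1}&=(-1)^{n-3}\frac{\tau_0\,\kappa\,(\alpha_1-\alpha_2)}{\tau_{-1}^3\gamma_1}\Bigl(-\frac u{\alpha_1}\Bigr)^{n-2}[1+O(r^n)],\\ (R_{\theta,n}^{-1})_{n-1,n-1}&=\Bigl\{\frac{C_{7,1}}{\rho_1^2}-\frac{C_{7,2}\gamma_2}{\gamma_1\rho_1^2}\Bigl(\frac{\alpha_2}{\alpha_1}\Bigr)^{n-4}\Bigr\}[1+O(r^n)],\\ (R_{\theta,n}^{-1})_{1,n}&=(-1)^{n+1}\frac{w^2u^2(\alpha_1-\alpha_2)}{\tau_{-1}\gamma_1}\Bigl(-\frac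 u{\alpha_1}\Bigr)^{n-2}[1+O(r^n)],\\ (R_{\theta,n}^{-1})_{2,n}&=(-1)^{n+2}\frac{\kappa(\alpha_1-\alpha_2)}{\tau_{-1}^2\gamma_1}\Bigl(-\frac u{\alpha_1}\Bigr)^{n-2}[1+O(r^n)],\\ (R_{\theta,n}^{-1})_{i,n}&=\frac{(-1)^{n+i}C_{6,1}\tau_{-1}^{n-i-2}\rho_1^{i-3}}{\rho_1^{n-2}}[1+O(r^n)]-\frac{(-1)^{n+i}C_{6,2}\tau_{-1}^{n-i-2}\gamma_2\rho_2^{i-3}}{\gamma_1\rho_1^{n-2}}[1+O(r^n)],\\ (R_{\theta,n}^{-1})_{n-1,n}&=-\frac{C_{3,1}}{\rho_1^2}[1+O(r^n)],\\ (R_{\theta,n}^{-1})_{n,n}&=-\frac1{(b+\tau_{-1}u)\alpha_1}[1+O(r^n)],\\ (R_{\theta,n}^{-1})_{1,1}&=-\frac1{(b+\tau_{-1}u)\alpha_1}[1+O(r^n)],\\ (R_{\theta,n}^{-1})_{2,1}&=-\frac{C_{3,1}}{\rho_1^2}[1+O(r^n)],\\ (R_{\theta,n}^{-1})_{i,1}&=\frac{(-1)^{i+1}C_{6,1}\tau_{-1}^{i-3}\rho_1^{n-i-2}}{\rho_1^{n-2}}[1+O(r^n)]-\frac{(-1)^{i+1}C_{6,2}\tau_{-1}^{i-3}\gamma_2\rho_2^{n-i-2}}{\gamma_1\rho_1^{n-2}}[1+O(r^n)],\\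 (R_{\theta,n}^{-1})_{n-1,1}&=(-1)^{n+2}\frac{\kappa(\alpha_1-\alpha_2)}{\tau_{-1}^2\gamma_1}\Bigl(-\frac u{\alpha_1}\Bigr)^{n-2}[1+O(r^n)]. \end{aligned}$$ -/

import Mathlib

namespace MaternInverse

noncomputable section

/-- The `n × n` matrix whose `(i, j)` entry is `(1 + θ|i - j|/n) exp(-θ|i - j|/n)`. Shifting the
indices from `1, …, n` to `0, …, n - 1` does not change `|i - j|`. -/
def R (θ : ℝ) (n : ℕ) : Matrix (Fin n) (Fin n) ℝ :=
  Matrix.of fun i j =>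
    (1 + θ * |((i : ℕ) : ℝ) - ((j : ℕ) : ℝ)| / n) *
      Real.exp (-(θ * |((i : ℕ) : ℝ) - ((j : ℕ) : ℝ)| / n))

/-- The element of `Fin n` that stands for the row or column number `k` when rows and columns are
numbered `1, …, n`. -/
def idx (n k : ℕ) (h : 1 ≤ k ∧ k ≤ n) : Fin n := ⟨k - 1, by omega⟩

/-- `u = e^{-w}`; all quantities below are functions of `w`, which will be `θ / n`. -/
def u (w : ℝ) : ℝ := Real.exp (-w)

/-- `τ_k`, for integers `k ≥ -2`. -/
def tau (k : ℤ) (w : ℝ) : ℝ :=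
  if k = -2 then 0
  else if k = -1 then (w - 1) * u w + (1 + w) * u w ^ 3
  else (1 + k * w) * u w ^ k - 2 * (1 + (k + 1) * w) * u w ^ (k + 2)
    + (1 + (k + 2) * w) * u w ^ (k + 4)

/-- `τ*_k`. -/
def tauStar (k : ℤ) (w : ℝ) : ℝ :=
  if 0 ≤ k then (1 + k * w) * u w ^ k - (1 + w) * (1 + (k + 1) * w) * u w ^ (k + 2)
  else 0

/-- `τ̂_k`, for integers `k ≥ -2`. -/
def tauHat (k : ℤ) (w : ℝ) : ℝ :=
  if k = -2 then 2 * tau (-1) w * u w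
  else if k = -1 then (1 + w) * u w - 3 * (1 + w) * u w ^ 3 + 2 * (1 + 2 * w) * u w ^ 5
  else (1 + k * w) * u w ^ k - 3 * (1 + (k + 2) * w) * u w ^ (k + 4)
    + 2 * (1 + (k + 3) * w) * u w ^ (k + 6)

/-- `τ̃_k`, for integers `k ≥ -2`. -/
def tauTilde (k : ℤ) (w : ℝ) : ℝ :=
  if k = -2 then tau (-1) w * u w / 2
  else if k = -1 then ((2 * w - 1) * u w + (1 + 2 * w) * u w ^ 5) / 2
  else (2 * (1 + k * w) * u w ^ k - 3 * (1 + (k + 1) * w) * u w ^ (k + 2)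
    + (1 + (k + 3) * w) * u w ^ (k + 6)) / 2

/-- `a`. -/
def a (w : ℝ) : ℝ := 1 - 2 * u w ^ 2 + u w ^ 4 - 2 * u w ^ 2 * w + 2 * u w ^ 4 * w

/-- `b`. -/
def b (w : ℝ) : ℝ := 2 * u w ^ 2 - u w ^ 4 + w - u w ^ 4 * w - 1

/-- `ã`. -/
def aTilde (w : ℝ) : ℝ := 1 - u w ^ 2 - 2 * u w ^ 2 * w - u w ^ 2 * w ^ 2

/-- `b̃`. -/
def bTilde (w : ℝ) : ℝ := u w ^ 2 + w + u w ^ 2 * w - 1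

/-- `α₁`. -/
def alpha1 (w : ℝ) : ℝ :=
  (-(a w - 2 * tau (-1) w * u w)
      - √((a w - 2 * tau (-1) w * u w) ^ 2 - 4 * tau (-1) w * u w * (b w + tau (-1) w * u w)))
    / (2 * (b w + tau (-1) w * u w))

/-- `α₂`. -/
def alpha2 (w : ℝ) : ℝ :=
  (-(a w - 2 * tau (-1) w * u w)
      + √((a w - 2 * tau (-1) w * u w) ^ 2 - 4 * tau (-1) w * u w * (b w + tau (-1) w * u w)))
    / (2 * (b w + tau (-1) w * u w))

/-- The constants `C_{3,i}`: `C_{3,1} = C3 w (alpha1 w)` and `C_{3,2} = C3 w (alpha2 w)`. -/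
def C3 (w α : ℝ) : ℝ :=
  tauHat (-1) w
    + tauHat (-2) w * u w * (w * (1 - 4 * u w ^ 2 + 3 * u w ^ 4) + (1 - u w ^ 2) ^ 2)
        / ((b w + tau (-1) w * u w) * α - tau (-1) w * u w)
    + w * tau (-1) w * u w ^ 2 * tauHat (-2) w * (1 - u w ^ 2) ^ 2
        / ((b w + tau (-1) w * u w) * α - tau (-1) w * u w) ^ 2

/-- The constants `C_{6,i}`: `C_{6,1} = C6 w (alpha1 w)` and `C_{6,2} = C6 w (alpha2 w)`. -/
def C6 (w α : ℝ) : ℝ :=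
  tauHat (-1) w * tauTilde (-1) w - tauHat 0 w * tauTilde (-2) w
    + tauHat (-2) w * u w * tauTilde (-1) w
        * (w * (1 - 4 * u w ^ 2 + 3 * u w ^ 4) + (1 - u w ^ 2) ^ 2)
        / ((b w + tau (-1) w * u w) * α - tau (-1) w * u w)
    - tauHat (-2) w * tauTilde (-2) w * u w ^ 2
        * (w * (2 - 6 * u w ^ 2 + 4 * u w ^ 4) + (1 - u w ^ 2) ^ 2)
        / ((b w + tau (-1) w * u w) * α - tau (-1) w * u w)
    + w * tau (-1) w * u w ^ 2 * tauHat (-2) w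
        * (tauTilde (-1) w - u w * tauTilde (-2) w) * (1 - u w ^ 2) ^ 2
        / ((b w + tau (-1) w * u w) * α - tau (-1) w * u w) ^ 2

/-- The constants `C_{7,i}`: `C_{7,1} = C7 w (alpha1 w)` and `C_{7,2} = C7 w (alpha2 w)`. -/
def C7 (w α : ℝ) : ℝ :=
  tauHat (-2) w * u w ^ 2 * (w * (2 - 6 * u w ^ 2 + 4 * u w ^ 4) + (1 - u w ^ 2) ^ 2)
      / ((b w + tau (-1) w * u w) * α - tau (-1) w * u w)
    + w * tau (-1) w * tauHat (-2) w * u w ^ 3 * (1 - u w ^ 2) ^ 2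
        / ((b w + tau (-1) w * u w) * α - tau (-1) w * u w) ^ 2
    + tauHat 0 w

/-- `-(b + τ_{-1} u) α`, to be used with `α = α₁` and `α = α₂`. -/
def rho (w α : ℝ) : ℝ := -((b w + tau (-1) w * u w) * α)

/-- `ã α + u² b̃`, to be used with `α = α₁` and `α = α₂`. -/
def gam (w α : ℝ) : ℝ := aTilde w * α + u w ^ 2 * bTilde w

/-- `τ̃_{-2} [(1 + 2w)² u⁴ - 1] + τ̃_{-1} τ*_1`. -/
def kap (w : ℝ) : ℝ :=
  tauTilde (-2) w * ((1 + 2 * w) ^ 2 * u w ^ 4 - 1) + tauTilde (-1) w * tauStar 1 w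

/-- `x = y [1 + e]` for some `e` with `|e| ≤ ε`. -/
def RelErr (x y ε : ℝ) : Prop := ∃ e : ℝ, |e| ≤ ε ∧ x = y * (1 + e)

end

end MaternInverse

open MaternInverse

/-! The matrix is symmetric Toeplitz with lag function `(1 + w k) u^k`, which has a double root `u`.
A bi-infinite geometric sequence `(-l)^j` is annihilated when `l` solves a palindromic quadratic
(`Param.qL_add_qR`). Its roots are `l` and `l⁻¹`, and `α₁ = -u/l`, `α₂ = -u l` (`exists_root`). On a
half line, the sequence with ratio `-l` and two corrected initial entries solves the system with
right side `e₀`; formally so does the one with `l⁻¹`. Subtracting `G` times the latter, and letting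
the last entry stand for the whole tail, gives a solution on the finite index set with right side
`(1 - G) e₀`, for exactly one tuned value of `G` (`row_sum_col`). A Toeplitz kernel argument then
gives invertibility (`isUnit_det_toeplitz`), so this solution is `1 - G` times the first column of
the inverse. Reflection, symmetry and one relation between the last two rows of the inverse
(`last_two_entries`) yield the other entries. The main terms are either the exact values multiplied
by `1 - G`, or these with the `l⁻¹` part dropped. Since `G ≤ l^(2(n-1))` and `1/5 ≤ l ≤ 2 - √3`,
with `(2 - √3)² = r`, all relative errors are `O(r^n)`. -/

namespace MaternInverse

/-! ### Rational identities in `u` and the characteristic root -/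

section Algebra

variable {u w l τ : ℝ}

/-- The rational parametrisation of `w` by `u` and a root `l` of the characteristic equation. -/
def Param (u w l : ℝ) : Prop :=
  w = (1 - u ^ 2) * (l + u) * (1 + u * l) / (u * ((1 + u ^ 2) * (1 + l ^ 2) + 4 * u * l))

/-- The characteristic equation is palindromic, so every identity proved for `l` also serves for the
other root `l⁻¹`. -/
lemma Param.inv (hu : 0 < u) (hl : 0 < l) (h : Param u w l) : Param u w l⁻¹ := by
  unfold Param at *
  rw [h]
  field_simp
  ring

/-- The characteristic equation is linear in `w`. Solving it for `w` turns all later identities into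
rational ones in free `u` and `l`; the relation `u = e^{-w}` plays no role in them. -/
lemma Param.of_char (hu : 0 < u) (hl : 0 < l)
    (h : ((w - 1) * u + (1 + w) * u ^ 3) * (l ^ 2 + 1) = (1 - u ^ 4 - 4 * u ^ 2 * w) * l) :
    Param u w l := by
  unfold Param
  field_simp
  linear_combination h

lemma Param.tau_neg_one (hu : 0 < u) (hl : 0 < l) (h : Param u w l) :
    (w - 1) * u + (1 + w) * u ^ 3
      = l * (1 - u ^ 2) ^ 3 / ((1 + u ^ 2) * (1 + l ^ 2) + 4 * u * l) := by
  unfold Param at h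
  rw [h]
  field_simp
  ring

lemma Param.tau_zero (hu : 0 < u) (hl : 0 < l) (h : Param u w l) :
    1 - 2 * (1 + w) * u ^ 2 + (1 + 2 * w) * u ^ 4
      = (1 - u ^ 2) ^ 3 * (1 + 2 * u * l + l ^ 2) / ((1 + u ^ 2) * (1 + l ^ 2) + 4 * u * l) := by
  unfold Param at h
  rw [h]
  field_simp
  ring

lemma Param.gamma (hu : 0 < u) (hl : 0 < l) (h : Param u w l) :
    (1 - u ^ 2 - 2 * u ^ 2 * w - u ^ 2 * w ^ 2) * -(u / l) + u ^ 2 * (u ^ 2 + w + u ^ 2 * w - 1)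
      = -(u * (1 - u ^ 2) ^ 2 * (1 + u * l) ^ 4
        / (l * ((1 + u ^ 2) * (1 + l ^ 2) + 4 * u * l) ^ 2)) := by
  unfold Param at h
  rw [h]
  field_simp
  ring

/-- Needs no characteristic equation. It makes the `κ` terms equal to the corner entry times powers
of `τ₀/τ₋₁`, up to sign. -/
lemma kappa_eq : (((w - 1) * u + (1 + w) * u ^ 3) * u / 2) * ((1 + 2 * w) ^ 2 * u ^ 4 - 1)
    + ((2 * w - 1) * u + (1 + 2 * w) * u ^ 5) / 2 * ((1 + w) * u - (1 + w) * (1 + 2 * w) * u ^ 3)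
    = (1 - 2 * (1 + w) * u ^ 2 + (1 + 2 * w) * u ^ 4) * (w ^ 2 * u ^ 2) := by
  ring

lemma Param.c3 (hu : 0 < u) (hl : 0 < l) (h : Param u w l) :
    (1 + w) * u - 3 * (1 + w) * u ^ 3 + 2 * (1 + 2 * w) * u ^ 5
      - 2 * u ^ 2 * l * (w * (1 - 4 * u ^ 2 + 3 * u ^ 4) + (1 - u ^ 2) ^ 2) / (1 + u * l)
      + 2 * w * u ^ 3 * l ^ 2 * (1 - u ^ 2) ^ 2 / (1 + u * l) ^ 2
      = (1 - u ^ 2) ^ 3 * (2 * u + l) / ((1 + u ^ 2) * (1 + l ^ 2) + 4 * u * l) := by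
  unfold Param at h
  rw [h]
  field_simp
  ring

lemma Param.c7 (hu : 0 < u) (hl : 0 < l) (h : Param u w l) :
    - 2 * u ^ 3 * l * (w * (2 - 6 * u ^ 2 + 4 * u ^ 4) + (1 - u ^ 2) ^ 2) / (1 + u * l)
      + 2 * w * u ^ 4 * l ^ 2 * (1 - u ^ 2) ^ 2 / (1 + u * l) ^ 2
      + (1 - 3 * (1 + 2 * w) * u ^ 4 + 2 * (1 + 3 * w) * u ^ 6)
      = (1 - u ^ 2) ^ 3 * ((1 + 2 * u * l + l ^ 2) * (2 * u + l) - 2 * u) /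
        (l * ((1 + u ^ 2) * (1 + l ^ 2) + 4 * u * l)) := by
  unfold Param at h
  rw [h]
  field_simp
  ring

lemma Param.c6 (hu : 0 < u) (hl : 0 < l) (h : Param u w l) :
    (2 * u + l) / l * (((2 * w - 1) * u + (1 + 2 * w) * u ^ 5) / 2)
      - ((1 + 2 * u * l + l ^ 2) * (2 * u + l) - 2 * u) / l ^ 2
        * (((w - 1) * u + (1 + w) * u ^ 3) * u / 2)
      = ((w - 1) * u + (1 + w) * u ^ 3) * (u + l) ^ 2 / l ^ 2 := by
  unfold Param at h
  rw [h]
  field_simp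
  ring

end Algebra

/-! ### Closed forms of the constants in terms of `l` -/

section Constants

variable {w l : ℝ}

lemma u_pos (w : ℝ) : 0 < u w := Real.exp_pos _

lemma u_lt_one (hw : 0 < w) : u w < 1 := by
  simpa [u] using hw

lemma tau_neg_one_eq (w : ℝ) : tau (-1) w = (w - 1) * u w + (1 + w) * u w ^ 3 := by
  simp [tau]

lemma tau_zero_eq (w : ℝ) :
    tau 0 w = 1 - 2 * (1 + w) * u w ^ 2 + (1 + 2 * w) * u w ^ 4 := by
  simp [tau]

lemma tauStar_one_eq (w : ℝ) :
    tauStar 1 w = (1 + w) * u w - (1 + w) * (1 + 2 * w) * u w ^ 3 := by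
  norm_num [tauStar]

lemma tauHat_neg_two_eq (w : ℝ) : tauHat (-2) w = 2 * tau (-1) w * u w := by
  simp [tauHat]

lemma tauHat_neg_one_eq (w : ℝ) :
    tauHat (-1) w = (1 + w) * u w - 3 * (1 + w) * u w ^ 3 + 2 * (1 + 2 * w) * u w ^ 5 := by
  simp [tauHat]

lemma tauHat_zero_eq (w : ℝ) :
    tauHat 0 w = 1 - 3 * (1 + 2 * w) * u w ^ 4 + 2 * (1 + 3 * w) * u w ^ 6 := by
  simp [tauHat]

lemma tauTilde_neg_two_eq (w : ℝ) : tauTilde (-2) w = tau (-1) w * u w / 2 := by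
  simp [tauTilde]

lemma tauTilde_neg_one_eq (w : ℝ) :
    tauTilde (-1) w = ((2 * w - 1) * u w + (1 + 2 * w) * u w ^ 5) / 2 := by
  simp [tauTilde]

lemma b_add_eq (w : ℝ) : b w + tau (-1) w * u w = tau (-1) w / u w := by
  have := u_pos w
  rw [tau_neg_one_eq, b]
  field_simp
  ring

lemma a_sub_eq (w : ℝ) : a w - 2 * tau (-1) w * u w = 1 - u w ^ 4 - 4 * u w ^ 2 * w := by
  rw [tau_neg_one_eq, a]
  ring

lemma kap_eq (w : ℝ) : kap w = tau 0 w * (w ^ 2 * u w ^ 2) := by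
  rw [kap, tauTilde_neg_two_eq, tauTilde_neg_one_eq, tauStar_one_eq, tau_zero_eq, tau_neg_one_eq]
  exact kappa_eq

lemma rho_eq (w l : ℝ) : rho w (-(u w / l)) = tau (-1) w / l := by
  have := u_pos w
  rw [rho, b_add_eq]
  field_simp

lemma denom_eq (hl : 0 < l) : (b w + tau (-1) w * u w) * -(u w / l) - tau (-1) w * u w
    = -(tau (-1) w * (1 + u w * l) / l) := by
  have := u_pos w
  rw [b_add_eq]
  field_simp
  ring

lemma tau_neg_one_pos (hl : 0 < l) (h : Param (u w) w l) (hw : 0 < w) : 0 < tau (-1) w := by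
  have h1 := u_pos w
  have h2 := u_lt_one hw
  have h3 : 0 < 1 - u w ^ 2 := by nlinarith
  rw [tau_neg_one_eq, h.tau_neg_one h1 hl]
  positivity

lemma tau_zero_eq_mul (hl : 0 < l) (h : Param (u w) w l) :
    tau 0 w = tau (-1) w * (1 + 2 * u w * l + l ^ 2) / l := by
  have h1 := u_pos w
  rw [tau_zero_eq, tau_neg_one_eq, h.tau_neg_one h1 hl, h.tau_zero h1 hl]
  field_simp

lemma C3_eq (hl : 0 < l) (h : Param (u w) w l) (hw : 0 < w) :
    C3 w (-(u w / l)) = tau (-1) w * (2 * u w + l) / l := by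
  have h1 := u_pos w
  have hτ := tau_neg_one_pos hl h hw
  have key := h.c3 h1 hl
  have e : (1 - u w ^ 2) ^ 3 * (2 * u w + l) / ((1 + u w ^ 2) * (1 + l ^ 2) + 4 * u w * l)
      = tau (-1) w * (2 * u w + l) / l := by
    rw [tau_neg_one_eq, h.tau_neg_one h1 hl]
    field_simp
  rw [C3, denom_eq hl, tauHat_neg_two_eq, tauHat_neg_one_eq, ← e, ← key]
  field_simp
  ring

lemma C7_eq (hl : 0 < l) (h : Param (u w) w l) (hw : 0 < w) : C7 w (-(u w / l))
    = tau (-1) w * ((1 + 2 * u w * l + l ^ 2) * (2 * u w + l) - 2 * u w) / l ^ 2 := by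
  have h1 := u_pos w
  have hτ := tau_neg_one_pos hl h hw
  have key := h.c7 h1 hl
  have e : (1 - u w ^ 2) ^ 3 * ((1 + 2 * u w * l + l ^ 2) * (2 * u w + l) - 2 * u w) /
        (l * ((1 + u w ^ 2) * (1 + l ^ 2) + 4 * u w * l))
      = tau (-1) w * ((1 + 2 * u w * l + l ^ 2) * (2 * u w + l) - 2 * u w) / l ^ 2 := by
    rw [tau_neg_one_eq, h.tau_neg_one h1 hl]
    field_simp
  rw [C7, denom_eq hl, tauHat_neg_two_eq, tauHat_zero_eq, ← e, ← key]
  field_simp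

lemma C6_eq (hl : 0 < l) (h : Param (u w) w l) (hw : 0 < w) :
    C6 w (-(u w / l)) = tau (-1) w ^ 2 * (u w + l) ^ 2 / l ^ 2 := by
  -- `C₆` is a combination of `C₃` and `C₇`, so only those two need the heavy rational identities.
  have e : C6 w (-(u w / l))
      = C3 w (-(u w / l)) * tauTilde (-1) w - C7 w (-(u w / l)) * tauTilde (-2) w := by
    rw [C6, C3, C7]
    ring
  have key := h.c6 (u_pos w) hl
  rw [e, C3_eq hl h hw, C7_eq hl h hw, tauTilde_neg_two_eq, tauTilde_neg_one_eq]
  rw [← tau_neg_one_eq] at key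
  linear_combination tau (-1) w * key

lemma gam_eq (hl : 0 < l) (h : Param (u w) w l) : gam w (-(u w / l))
    = -(u w * (1 - u w ^ 2) ^ 2 * (1 + u w * l) ^ 4
        / (l * ((1 + u w ^ 2) * (1 + l ^ 2) + 4 * u w * l) ^ 2)) := by
  rw [gam, aTilde, bTilde, h.gamma (u_pos w) hl]

end Constants

/-! ### Hyperbolic inequalities locating the root -/

section Hyperbolic

open Real

lemma mul_cosh_sub_sinh_pos {w : ℝ} (hw : 0 < w) : 0 < w * cosh w - sinh w := by
  have hd : ∀ x, HasDerivAt (fun x => x * cosh x - sinh x) (x * sinh x) x := fun x => by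
    refine (((hasDerivAt_id x).mul (hasDerivAt_cosh x)).sub (hasDerivAt_sinh x)).congr_deriv ?_
    simp only [id]
    ring
  have hmono : StrictMonoOn (fun x => x * cosh x - sinh x) (Set.Ici 0) := by
    refine strictMonoOn_of_deriv_pos (convex_Ici 0)
      (fun x _ => (hd x).continuousAt.continuousWithinAt) fun x hx => ?_
    rw [interior_Ici, Set.mem_Ioi] at hx
    rw [(hd x).deriv]
    exact mul_pos hx (sinh_pos_iff.2 hx)
  simpa using hmono Set.self_mem_Ici hw.le hw

lemma hasDerivAt_sinh_mul_cosh (x : ℝ) :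
    HasDerivAt (fun x => sinh x * cosh x) (1 + 2 * sinh x ^ 2) x := by
  refine ((hasDerivAt_sinh x).mul (hasDerivAt_cosh x)).congr_deriv ?_
  linear_combination cosh_sq x

/-- The difference has derivative `2 sinh x (sinh x - x) ≥ 0`. The factor 2 is sharp as `w → 0`,
both sides being `~ 2w³/3`; this is what produces the bound `2 - √3`. -/
lemma two_mul_le_sinh_mul_cosh {w : ℝ} (hw : 0 ≤ w) :
    2 * (w * cosh w - sinh w) ≤ sinh w * cosh w - w := by
  have hd : ∀ x, HasDerivAt (fun x => sinh x * cosh x - x - 2 * (x * cosh x - sinh x))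
      (2 * sinh x * (sinh x - x)) x := fun x => by
    refine (((hasDerivAt_sinh_mul_cosh x).sub (hasDerivAt_id x)).sub
      ((((hasDerivAt_id x).mul (hasDerivAt_cosh x)).sub
        (hasDerivAt_sinh x)).const_mul 2)).congr_deriv ?_
    simp only [id]
    ring
  have hmono : MonotoneOn (fun x => sinh x * cosh x - x - 2 * (x * cosh x - sinh x))
      (Set.Ici 0) := by
    refine monotoneOn_of_deriv_nonneg (convex_Ici 0)
      (fun x _ => (hd x).continuousAt.continuousWithinAt)
      (fun x _ => (hd x).differentiableAt.differentiableWithinAt) fun x hx => ?_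
    rw [interior_Ici, Set.mem_Ioi] at hx
    rw [(hd x).deriv]
    have h1 := sinh_pos_iff.2 hx
    have h2 := self_le_sinh_iff.2 hx.le
    exact mul_nonneg (by positivity) (by linarith)
  have := hmono Set.self_mem_Ici hw hw
  simp only [sinh_zero, cosh_zero] at this
  linarith

lemma sinh_le_five_fourths {w : ℝ} (hw : 0 ≤ w) (hw' : w ≤ 1 / 2) : sinh w ≤ 5 / 4 * w := by
  have hd : ∀ x, HasDerivAt (fun x => 5 / 4 * x - sinh x) (5 / 4 - cosh x) x := fun x => by
    refine (((hasDerivAt_id x).const_mul (5 / 4)).sub (hasDerivAt_sinh x)).congr_deriv ?_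
    ring
  have hmono : MonotoneOn (fun x => 5 / 4 * x - sinh x) (Set.Icc 0 (1 / 2)) := by
    refine monotoneOn_of_deriv_nonneg (convex_Icc 0 (1 / 2))
      (fun x _ => (hd x).continuousAt.continuousWithinAt)
      (fun x _ => (hd x).differentiableAt.differentiableWithinAt) fun x hx => ?_
    rw [interior_Icc, Set.mem_Ioo] at hx
    rw [(hd x).deriv]
    have h1 : cosh x ≤ exp (1 / 8) :=
      (cosh_le_exp_half_sq x).trans (exp_le_exp.2 (by nlinarith))
    have h2 : exp (1 / 8) ≤ 1 / (1 - 1 / 8) :=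
      exp_bound_div_one_sub_of_interval (by norm_num) (by norm_num)
    norm_num at h2
    linarith
  have := hmono (Set.left_mem_Icc.2 (by norm_num)) ⟨hw, hw'⟩ hw
  simp only [sinh_zero] at this
  linarith

/-- The derivative of the difference has the sign of `5/4 x - sinh x`, hence the restriction to `[0,
1/2]`. The only purpose is to keep `l` away from 0. -/
lemma sinh_mul_cosh_le {w : ℝ} (hw : 0 ≤ w) (hw' : w ≤ 1 / 2) :
    2 * (sinh w * cosh w - w) ≤ 5 * (w * cosh w - sinh w) := by
  have hd : ∀ x, HasDerivAt (fun x => 5 * (x * cosh x - sinh x) - 2 * (sinh x * cosh x - x))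
      (4 * sinh x * (5 / 4 * x - sinh x)) x := fun x => by
    refine (((((hasDerivAt_id x).mul (hasDerivAt_cosh x)).sub (hasDerivAt_sinh x)).const_mul
      5).sub (((hasDerivAt_sinh_mul_cosh x).sub (hasDerivAt_id x)).const_mul 2)).congr_deriv ?_
    simp only [id]
    ring
  have hmono : MonotoneOn (fun x => 5 * (x * cosh x - sinh x) - 2 * (sinh x * cosh x - x))
      (Set.Icc 0 (1 / 2)) := by
    refine monotoneOn_of_deriv_nonneg (convex_Icc 0 (1 / 2))
      (fun x _ => (hd x).continuousAt.continuousWithinAt)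
      (fun x _ => (hd x).differentiableAt.differentiableWithinAt) fun x hx => ?_
    rw [interior_Icc, Set.mem_Ioo] at hx
    rw [(hd x).deriv]
    have h1 := sinh_pos_iff.2 hx.1
    have h2 := sinh_le_five_fourths hx.1.le hx.2.le
    exact mul_nonneg (by positivity) (by linarith)
  have := hmono (Set.left_mem_Icc.2 (by norm_num)) ⟨hw, hw'⟩ hw
  simp only [sinh_zero, cosh_zero] at this
  linarith

lemma exp_eq_inv_u (w : ℝ) : exp w = (u w)⁻¹ := by
  rw [u, exp_neg, inv_inv]

lemma tau_neg_one_eq_hyperbolic (w : ℝ) :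
    tau (-1) w = u w ^ 2 * (2 * (w * cosh w - sinh w)) := by
  have := u_pos w
  rw [tau_neg_one_eq, cosh_eq, sinh_eq, exp_eq_inv_u, ← u]
  field_simp
  ring

lemma a_sub_eq_hyperbolic (w : ℝ) :
    a w - 2 * tau (-1) w * u w = u w ^ 2 * (4 * (sinh w * cosh w - w)) := by
  have := u_pos w
  rw [a_sub_eq, cosh_eq, sinh_eq, exp_eq_inv_u, ← u]
  field_simp
  ring

/-- The smaller root `l` of the characteristic equation, with bounds, and the expression of
`α₁` and `α₂` through it. -/
lemma exists_root {w : ℝ} (hw : 0 < w) (hw' : w ≤ 1 / 2) :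
    ∃ l, 1 / 5 ≤ l ∧ l ≤ 2 - √3 ∧ Param (u w) w l ∧
      alpha1 w = -(u w / l) ∧ alpha2 w = -(u w / l⁻¹) := by
  have hu := u_pos w
  set t := tau (-1) w with ht
  set A := a w - 2 * t * u w with hA
  have ht0 : 0 < t := by
    rw [ht, tau_neg_one_eq_hyperbolic]
    have := mul_cosh_sub_sinh_pos hw
    positivity
  -- `A / t = l + l⁻¹`. The bound 4 forces `l ≤ 2 - √3`, the smaller root of `x² - 4x + 1`; the
  -- bound 5 forces `l⁻¹ ≤ 5`.
  have h4 : 4 * t ≤ A := by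
    rw [hA, ht, a_sub_eq_hyperbolic, tau_neg_one_eq_hyperbolic]
    have := mul_le_mul_of_nonneg_left (two_mul_le_sinh_mul_cosh hw.le) (sq_nonneg (u w))
    linarith
  have h5 : A ≤ 5 * t := by
    rw [hA, ht, a_sub_eq_hyperbolic, tau_neg_one_eq_hyperbolic]
    have := mul_le_mul_of_nonneg_left (sinh_mul_cosh_le hw.le hw') (sq_nonneg (u w))
    linarith
  have hB : b w + t * u w = t / u w := b_add_eq w
  have hdisc : A ^ 2 - 4 * t * u w * (t / u w) = A ^ 2 - 4 * t ^ 2 := by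
    field_simp
  have hpos : 0 ≤ A ^ 2 - 4 * t ^ 2 := by nlinarith
  set s := √(A ^ 2 - 4 * t ^ 2) with hs
  have hs2 : s ^ 2 = A ^ 2 - 4 * t ^ 2 := sq_sqrt hpos
  have hs0 : 0 ≤ s := sqrt_nonneg _
  have hsA : s < A := by nlinarith
  set l := (A - s) / (2 * t) with hl
  have hl0 : 0 < l := div_pos (by linarith) (by linarith)
  have hinv : l⁻¹ = (A + s) / (2 * t) := by
    rw [hl, inv_div, div_eq_div_iff (by linarith) (by linarith)]
    linear_combination 1 * hs2
  have hchar : t * (l ^ 2 + 1) = A * l := by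
    rw [hl]
    field_simp
    linear_combination hs2
  refine ⟨l, ?_, ?_, ?_, ?_, ?_⟩
  · have : l⁻¹ ≤ 5 := by
      rw [hinv, div_le_iff₀ (by linarith)]
      linarith
    rw [one_div]
    exact inv_le_of_inv_le₀ hl0 this
  · have h3 : √3 ^ 2 = 3 := sq_sqrt (by norm_num)
    have h30 : 0 ≤ √3 := sqrt_nonneg 3
    have h4' : 4 * l ≤ l ^ 2 + 1 := by
      have := mul_le_mul_of_nonneg_right h4 hl0.le
      rw [← hchar] at this
      nlinarith
    have hl1 : l ≤ 1 := by
      rw [hl, div_le_one (by linarith)]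
      nlinarith
    nlinarith
  · apply Param.of_char hu hl0
    rw [← tau_neg_one_eq, ← a_sub_eq]
    exact hchar
  -- The minus sign in `α₁` makes the numerator `-(A + s)`, which is the larger root `l⁻¹` up to a
  -- factor.
  · rw [alpha1, ← ht, ← hA, hB, hdisc, ← hs, div_eq_mul_inv (u w) l, hinv]
    field_simp
    ring
  · rw [alpha2, ← ht, ← hA, hB, hdisc, ← hs, div_inv_eq_mul, hl]
    field_simp
    ring

end Hyperbolic

/-! ### Symmetric Toeplitz matrices: symmetries and invertibility -/

section Toeplitz

open Matrix

variable {m : ℕ} {f : ℕ → ℝ}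

/-- The symmetric Toeplitz matrix with first column `f`. -/
def toeplitz (f : ℕ → ℝ) (n : ℕ) : Matrix (Fin n) (Fin n) ℝ :=
  Matrix.of fun i j => f (Int.natAbs ((i : ℤ) - j))

lemma toeplitz_transpose (f : ℕ → ℝ) (n : ℕ) : (toeplitz f n)ᵀ = toeplitz f n := by
  ext i j
  simp only [toeplitz, transpose_apply, of_apply]
  congr 1
  omega

lemma toeplitz_rev (f : ℕ → ℝ) (n : ℕ) (i j : Fin n) :
    toeplitz f n i.rev j.rev = toeplitz f n i j := by
  simp only [toeplitz, of_apply, Fin.val_rev]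
  congr 1
  omega

lemma toeplitz_submatrix_rev (f : ℕ → ℝ) (n : ℕ) :
    (toeplitz f n).submatrix Fin.revPerm Fin.revPerm = toeplitz f n := by
  ext i j
  exact toeplitz_rev f n i j

lemma toeplitz_inv_rev (f : ℕ → ℝ) (n : ℕ) (i j : Fin n) :
    (toeplitz f n)⁻¹ i.rev j.rev = (toeplitz f n)⁻¹ i j := by
  have h := inv_submatrix_equiv (toeplitz f n) Fin.revPerm Fin.revPerm
  rw [toeplitz_submatrix_rev] at h
  exact (congrFun (congrFun h i) j).symm

lemma toeplitz_inv_symm (f : ℕ → ℝ) (n : ℕ) (i j : Fin n) :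
    (toeplitz f n)⁻¹ i j = (toeplitz f n)⁻¹ j i := by
  have h := transpose_nonsing_inv (toeplitz f n)
  rw [toeplitz_transpose] at h
  exact congrFun (congrFun h j) i

lemma toeplitz_mulVec_rev (f : ℕ → ℝ) (n : ℕ) (v : Fin n → ℝ) (i : Fin n) :
    (toeplitz f n *ᵥ fun j => v j.rev) i = (toeplitz f n *ᵥ v) i.rev := by
  simp only [mulVec, dotProduct]
  rw [← Equiv.sum_comp Fin.revPerm]
  refine Finset.sum_congr rfl fun j _ => ?_
  rw [← toeplitz_rev f n i]
  simp

/-- A symmetric Toeplitz matrix is invertible as soon as its inverse has a first column, with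
nonzero first entry. -/
theorem isUnit_det_toeplitz {x : Fin (m + 1) → ℝ}
    (hx : toeplitz f (m + 1) *ᵥ x = Pi.single 0 1) (hx0 : x 0 ≠ 0) :
    IsUnit (toeplitz f (m + 1)).det := by
  set T := toeplitz f (m + 1) with hT
  -- `v₀ = ⟨Tx, v⟩ = ⟨x, Tv⟩ = 0`; reversal then handles the last entry.
  have hzero : ∀ v, T *ᵥ v = 0 → v 0 = 0 := fun v hv => by
    have h1 : (T *ᵥ x) ⬝ᵥ v = x ⬝ᵥ (T *ᵥ v) := by
      rw [dotProduct_mulVec, ← mulVec_transpose, toeplitz_transpose]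
    simpa [hx, hv] using h1
  have hlast : ∀ v, T *ᵥ v = 0 → v (Fin.last m) = 0 := fun v hv => by
    have h1 := hzero (fun j => v j.rev) <| by
      ext i
      rw [toeplitz_mulVec_rev, hv]
      rfl
    simpa using h1
  -- The kernel is stable under the left shift. As `v₀ = 0`, the shifted vector `y` satisfies every
  -- equation but the last, so `T y = c e_last`.
  have hshift : ∀ v, T *ᵥ v = 0 →
      T *ᵥ (Fin.snoc (fun i : Fin m => v i.succ) 0 : Fin (m + 1) → ℝ) = 0 := fun v hv => by
    set y : Fin (m + 1) → ℝ := Fin.snoc (fun i : Fin m => v i.succ) 0 with hy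
    have hy_init : ∀ i : Fin m, (T *ᵥ y) i.castSucc = 0 := fun i => by
      have h1 : (T *ᵥ v) i.succ = 0 := by rw [hv]; rfl
      rw [← h1]
      simp only [mulVec, dotProduct]
      rw [Fin.sum_univ_castSucc, Fin.sum_univ_succ, hzero v hv]
      simp only [hy, Fin.snoc_castSucc, Fin.snoc_last, mul_zero, add_zero, zero_add]
      refine Finset.sum_congr rfl fun j _ => ?_
      congr 1
      simp only [hT, toeplitz, of_apply, Fin.val_castSucc, Fin.val_succ]
      congr 1
      omega
    set c := (T *ᵥ y) (Fin.last m) with hc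
    -- The reversal of `x` solves the system for `e_last`. The last entry of this kernel vector is
    -- `-c x₀`, so `c = 0`.
    have hker : T *ᵥ (y - c • fun j => x j.rev) = 0 := by
      ext i
      rw [mulVec_sub, mulVec_smul, Pi.sub_apply, Pi.smul_apply, toeplitz_mulVec_rev, hx]
      induction i using Fin.lastCases with
      | last => simp [← hc]
      | cast i =>
        have hi : i.castSucc.rev ≠ 0 := by
          rw [Ne, Fin.ext_iff, Fin.val_rev]
          simp only [Fin.val_castSucc, Fin.val_zero]
          omega
        rw [hy_init i, Pi.single_eq_of_ne hi, smul_zero, sub_zero, Pi.zero_apply]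
    have h2 := hlast _ hker
    have hc0 : c = 0 := by simpa [hy, hx0] using h2
    rw [hc0, zero_smul, sub_zero] at hker
    exact hker
  -- Entry `k` of `v` is the first entry of its `k`-th shift.
  have hall : ∀ k (hk : k < m + 1), ∀ v, T *ᵥ v = 0 → v ⟨k, hk⟩ = 0 := by
    intro k
    induction k with
    | zero => exact fun _ v hv => hzero v hv
    | succ k ih =>
      intro hk v hv
      have h1 := ih (by omega) _ (hshift v hv)
      have h2 : (⟨k, by omega⟩ : Fin (m + 1)) = Fin.castSucc ⟨k, by omega⟩ := rfl
      rw [h2, Fin.snoc_castSucc] at h1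
      exact h1
  rw [isUnit_iff_ne_zero]
  intro hdet
  obtain ⟨v, hv0, hv⟩ := exists_mulVec_eq_zero_iff.2 hdet
  exact hv0 (funext fun i => hall i i.2 v hv)

lemma inv_col_eq {n : ℕ} {T : Matrix (Fin n) (Fin n) ℝ} (hT : IsUnit T.det) {x : Fin n → ℝ}
    {j : Fin n} (hx : T *ᵥ x = Pi.single j 1) (i : Fin n) : T⁻¹ i j = x i := by
  have h : T⁻¹ *ᵥ (T *ᵥ x) = x := by
    rw [mulVec_mulVec, nonsing_inv_mul T hT, one_mulVec]
  rw [hx, mulVec_single_one] at h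
  exact congrFun h i

end Toeplitz

/-! ### Geometric sequences on a half line -/

section HalfLine

variable {u w l τ : ℝ}

/-- Ratio of `∑_{j ≤ i} u^(i-j) x_j` to `x_i` for a sequence with ratio `-l`. -/
noncomputable def pL (u l : ℝ) : ℝ := l / (l + u)

/-- Ratio of `∑_{j ≤ i} (1 + w(i-j)) u^(i-j) x_j` to `x_i` for a sequence with ratio `-l`. -/
noncomputable def qL (u w l : ℝ) : ℝ := (l - w * u * pL u l) / (l + u)

/-- Ratio of `∑_{j ≥ i} u^(j-i) x_j` to `x_i` for a sequence with ratio `-l`. -/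
noncomputable def pR (u l : ℝ) : ℝ := 1 / (1 + u * l)

/-- Ratio of `∑_{j ≥ i} (1 + w(j-i)) u^(j-i) x_j` to `x_i` for a sequence with ratio `-l`. -/
noncomputable def qR (u w l : ℝ) : ℝ := pR u l - w * u * l * pR u l ^ 2

/-- The geometric part of the first column of the inverse. -/
noncomputable def geo (u τ l : ℝ) (j : ℕ) : ℝ := (l + u) ^ 2 / (l * τ) * (-l) ^ j

lemma geo_succ (u τ l : ℝ) (j : ℕ) : geo u τ l (j + 1) = -l * geo u τ l j := by
  rw [geo, geo, pow_succ]
  ring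

/-- This and the next three say that the ratios are preserved when one term is split off the sum,
which drives the inductions along the column. -/
lemma pL_rec (hu : 0 < u) (hl : 0 < l) : pL u l * -l = u * pL u l - l := by
  rw [pL]
  field_simp
  ring

lemma qL_rec (hu : 0 < u) (hl : 0 < l) :
    qL u w l * -l = u * qL u w l + w * u * pL u l - l := by
  rw [qL]
  field_simp
  ring

lemma pR_rec (hu : 0 < u) (hl : 0 < l) : pR u l = 1 - u * l * pR u l := by
  rw [pR]
  field_simp
  ring

lemma qR_rec (hu : 0 < u) (hl : 0 < l) :
    qR u w l = 1 - u * l * qR u w l - w * u * l * pR u l := by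
  rw [qR, pR]
  field_simp
  ring

/-- This is the characteristic equation: left and right sums both count `x_i`, so a full row sum is
`(qL + qR - 1) x_i`. -/
lemma Param.qL_add_qR (hu : 0 < u) (hl : 0 < l) (h : Param u w l) : qL u w l + qR u w l = 1 := by
  unfold Param at h
  rw [qL, qR, pL, pR, h]
  field_simp
  ring

lemma geo_two (u τ l : ℝ) : geo u τ l 2 = (l + u) ^ 2 * l / τ := by
  rw [geo]
  by_cases hl : l = 0
  · simp [hl]
  · field_simp

/-- Together with the weighted version, two conditions that fix the entries at 0 and 1: from index 2
on, the left sums behave as if the sequence were purely geometric. -/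
lemma start_left (hl : 0 < l) (hτ : 0 < τ) :
    geo u τ l 2 + u * (-(l * (2 * u + l) / τ) + u * (l / τ)) = pL u l * geo u τ l 2 := by
  rw [geo_two, pL]
  field_simp
  ring

lemma start_left_weighted (hu : 0 < u) (hl : 0 < l) (hτ : 0 < τ) :
    geo u τ l 2 + u * (-(l * (2 * u + l) / τ) + u * (l / τ) + w * u * (l / τ))
      + w * u * (-(l * (2 * u + l) / τ) + u * (l / τ)) = qL u w l * geo u τ l 2 := by
  rw [geo_two, qL, pL]
  field_simp
  ring

lemma Param.row_one (hu : 0 < u) (hl : 0 < l) (h : Param u w l) :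
    u * (1 + w) * (l / τ) + -(l * (2 * u + l) / τ)
      + u * (qR u w l * geo u τ l 2) + w * u * (pR u l * geo u τ l 2) = 0 := by
  have key : u * (1 + w) - (2 * u + l)
      + (u * qR u w l + w * u * pR u l) * (l + u) ^ 2 = 0 := by
    unfold Param at h
    rw [qR, pR, h]
    field_simp
    ring
  rw [geo_two]
  linear_combination l / τ * key

/-- The one inhomogeneous equation; it fixes the factor `1/τ`. -/
lemma Param.row_zero (hu : 0 < u) (hl : 0 < l) (h : Param u w l) (hτ : 0 < τ)
    (hτ' : τ = (w - 1) * u + (1 + w) * u ^ 3) :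
    l / τ + u * (-(l * (2 * u + l) / τ) + u * (qR u w l * geo u τ l 2)
        + w * u * (pR u l * geo u τ l 2))
      + w * u * (-(l * (2 * u + l) / τ) + u * (pR u l * geo u τ l 2)) = 1 := by
  have key : l * (1 - u * (2 * u + l) * (1 + w)
      + (u ^ 2 * qR u w l + 2 * w * u ^ 2 * pR u l) * (l + u) ^ 2) = τ := by
    rw [hτ']
    unfold Param at h
    rw [qR, pR, h]
    field_simp
    ring
  rw [geo_two]
  field_simp
  linear_combination key

end HalfLine

/-! ### The exact first column on a finite index set -/

section Column

open Finset

variable {u w l τ G : ℝ} {N : ℕ}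

lemma weighted_sum_succ (u w : ℝ) (Y : ℕ → ℝ) (k : ℕ) :
    ∑ j ∈ range (k + 2), (1 + w * j) * u ^ j * Y j
      = Y 0 + u * ∑ j ∈ range (k + 1), (1 + w * j) * u ^ j * Y (j + 1)
        + w * u * ∑ j ∈ range (k + 1), u ^ j * Y (j + 1) := by
  rw [sum_range_succ', mul_sum, mul_sum, add_comm, add_assoc, ← sum_add_distrib]
  congr 1
  · simp
  · refine sum_congr rfl fun j _ => ?_
    push_cast
    ring

lemma power_sum_succ (u : ℝ) (Y : ℕ → ℝ) (k : ℕ) :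
    ∑ j ∈ range (k + 2), u ^ j * Y j = Y 0 + u * ∑ j ∈ range (k + 1), u ^ j * Y (j + 1) := by
  rw [sum_range_succ', mul_sum, add_comm]
  congr 1
  · simp
  · exact sum_congr rfl fun j _ => by ring

/-- `∑_{j ≤ i} u^(i-j) X_j`. -/
noncomputable def leftSum (u : ℝ) (X : ℕ → ℝ) (i : ℕ) : ℝ :=
  ∑ j ∈ range (i + 1), u ^ j * X (i - j)

/-- `∑_{j ≤ i} (1 + w(i-j)) u^(i-j) X_j`. -/
noncomputable def leftWeighted (u w : ℝ) (X : ℕ → ℝ) (i : ℕ) : ℝ :=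
  ∑ j ∈ range (i + 1), (1 + w * j) * u ^ j * X (i - j)

/-- `∑_{i ≤ j ≤ i+k} u^(j-i) X_j`. -/
noncomputable def rightSum (u : ℝ) (X : ℕ → ℝ) (i k : ℕ) : ℝ :=
  ∑ j ∈ range (k + 1), u ^ j * X (i + j)

/-- `∑_{i ≤ j ≤ i+k} (1 + w(j-i)) u^(j-i) X_j`. -/
noncomputable def rightWeighted (u w : ℝ) (X : ℕ → ℝ) (i k : ℕ) : ℝ :=
  ∑ j ∈ range (k + 1), (1 + w * j) * u ^ j * X (i + j)

variable (X : ℕ → ℝ)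

lemma leftSum_zero (u : ℝ) : leftSum u X 0 = X 0 := by simp [leftSum]

lemma leftWeighted_zero (u w : ℝ) : leftWeighted u w X 0 = X 0 := by simp [leftWeighted]

lemma rightSum_zero (u : ℝ) (i : ℕ) : rightSum u X i 0 = X i := by simp [rightSum]

lemma rightWeighted_zero (u w : ℝ) (i : ℕ) : rightWeighted u w X i 0 = X i := by
  simp [rightWeighted]

lemma leftSum_succ (u : ℝ) (i : ℕ) : leftSum u X (i + 1) = X (i + 1) + u * leftSum u X i := by
  rw [leftSum, power_sum_succ]
  simp [leftSum]

lemma leftWeighted_succ (u w : ℝ) (i : ℕ) : leftWeighted u w X (i + 1)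
    = X (i + 1) + u * leftWeighted u w X i + w * u * leftSum u X i := by
  rw [leftWeighted, weighted_sum_succ]
  simp [leftSum, leftWeighted]

lemma rightSum_succ (u : ℝ) (i k : ℕ) :
    rightSum u X i (k + 1) = X i + u * rightSum u X (i + 1) k := by
  rw [rightSum, power_sum_succ]
  simp [rightSum, add_assoc, add_comm 1]

lemma rightWeighted_succ (u w : ℝ) (i k : ℕ) : rightWeighted u w X i (k + 1)
    = X i + u * rightWeighted u w X (i + 1) k + w * u * rightSum u X (i + 1) k := by
  rw [rightWeighted, weighted_sum_succ]
  simp [rightSum, rightWeighted, add_assoc, add_comm 1]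

lemma row_sum_eq (u w : ℝ) (i k : ℕ) :
    ∑ j ∈ range (i + k + 1), (1 + w * (Int.natAbs ((i : ℤ) - j) : ℝ))
        * u ^ Int.natAbs ((i : ℤ) - j) * X j
      = leftWeighted u w X i + rightWeighted u w X i k - X i := by
  rw [show i + k + 1 = i + 1 + k by ring, sum_range_add, leftWeighted, ← sum_range_reflect,
    rightWeighted, sum_range_succ' _ k]
  have h1 : ∀ j ∈ range (i + 1), (1 + w * (Int.natAbs ((i : ℤ) - (i + 1 - 1 - j : ℕ)) : ℝ))
      * u ^ Int.natAbs ((i : ℤ) - (i + 1 - 1 - j : ℕ)) * X (i + 1 - 1 - j)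
      = (1 + w * j) * u ^ j * X (i - j) := fun j hj => by
    have hj' := mem_range.1 hj
    have e : Int.natAbs ((i : ℤ) - (i + 1 - 1 - j : ℕ)) = j := by omega
    rw [e, Nat.add_sub_cancel]
  have h2 : ∀ j ∈ range k, (1 + w * (Int.natAbs ((i : ℤ) - (i + 1 + j : ℕ)) : ℝ))
      * u ^ Int.natAbs ((i : ℤ) - (i + 1 + j : ℕ)) * X (i + 1 + j)
      = (1 + w * (j + 1 : ℕ)) * u ^ (j + 1) * X (i + (j + 1)) := fun j _ => by
    have e : Int.natAbs ((i : ℤ) - (i + 1 + j : ℕ)) = j + 1 := by omega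
    rw [e, show i + 1 + j = i + (j + 1) by ring]
  rw [sum_congr rfl h1, sum_congr rfl h2]
  simp
  ring

/-- The first column of the inverse, up to the factor `1 - G`; here `N + 1` is the size. -/
noncomputable def col (u τ l G : ℝ) (N j : ℕ) : ℝ :=
  if j = 0 then l / τ - G * (l⁻¹ / τ)
  else if j = 1 then -(l * (2 * u + l) / τ) - G * -(l⁻¹ * (2 * u + l⁻¹) / τ)
  else if j < N then geo u τ l j - G * geo u τ l⁻¹ j
  else pR u l * geo u τ l N - G * (pR u l⁻¹ * geo u τ l⁻¹ N)

lemma col_zero : col u τ l G N 0 = l / τ - G * (l⁻¹ / τ) := by simp [col]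

lemma col_one :
    col u τ l G N 1 = -(l * (2 * u + l) / τ) - G * -(l⁻¹ * (2 * u + l⁻¹) / τ) := by simp [col]

lemma col_mid {j : ℕ} (h : 2 ≤ j) (h' : j < N) :
    col u τ l G N j = geo u τ l j - G * geo u τ l⁻¹ j := by
  rw [col, if_neg (by omega), if_neg (by omega), if_pos h']

lemma col_last (h : 2 ≤ N) :
    col u τ l G N N = pR u l * geo u τ l N - G * (pR u l⁻¹ * geo u τ l⁻¹ N) := by
  rw [col, if_neg (by omega), if_neg (by omega), if_neg (by omega)]

/-- The value of `G` for which the last entry of the column can be chosen consistently. -/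
lemma pR_geo_eq_qR_geo (hu : 0 < u) (hl : 0 < l)
    (hG : G = l ^ (2 * N) * ((l + u) / (1 + u * l)) ^ 4) (w : ℝ) :
    pR u l * geo u τ l N - G * (pR u l⁻¹ * geo u τ l⁻¹ N)
      = qR u w l * geo u τ l N - G * (qR u w l⁻¹ * geo u τ l⁻¹ N) := by
  -- Since `pR - qR = w u l pR²`, this is equality of the plain and the weighted tail. A single last
  -- entry can replace both only then, and it determines `G`.
  have key : l * pR u l ^ 2 * geo u τ l N = G * (l⁻¹ * pR u l⁻¹ ^ 2 * geo u τ l⁻¹ N) := by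
    have e : (-l⁻¹) ^ N * l ^ (2 * N) = (-l) ^ N := by
      rw [pow_mul, ← mul_pow]
      congr 1
      field_simp
    have e2 : l * (1 / (1 + u * l)) ^ 2 * ((l + u) ^ 2 / l)
        = ((l + u) / (1 + u * l)) ^ 4 *
          (l⁻¹ * (1 / (1 + u * l⁻¹)) ^ 2 * ((l⁻¹ + u) ^ 2 / l⁻¹)) := by
      field_simp
    rw [hG, geo, geo, pR, pR, ← e]
    simp only [← div_div]
    linear_combination (-l⁻¹) ^ N * l ^ (2 * N) / τ * e2
  rw [qR, qR]
  linear_combination w * u * key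

variable {X}

lemma col_left (hu : 0 < u) (hl : 0 < l) (hτ : 0 < τ) {i : ℕ} (hi : 2 ≤ i) (hi' : i < N) :
    leftSum u (col u τ l G N) i = pL u l * geo u τ l i - G * (pL u l⁻¹ * geo u τ l⁻¹ i) ∧
    leftWeighted u w (col u τ l G N) i
      = qL u w l * geo u τ l i - G * (qL u w l⁻¹ * geo u τ l⁻¹ i) := by
  have hl' := inv_pos.2 hl
  induction i, hi using Nat.le_induction with
  | base =>
    simp only [leftSum_succ, leftWeighted_succ, leftSum_zero, leftWeighted_zero, zero_add,
      Nat.reduceAdd, col_zero, col_one, col_mid le_rfl hi']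
    constructor
    · linear_combination start_left hl hτ - G * start_left hl' hτ
    · linear_combination start_left_weighted (w := w) hu hl hτ
        - G * start_left_weighted (w := w) hu hl' hτ
  | succ i hi ih =>
    obtain ⟨h1, h2⟩ := ih (by omega)
    rw [leftSum_succ, leftWeighted_succ, h1, h2, col_mid (by omega) hi', geo_succ, geo_succ]
    constructor
    · linear_combination -geo u τ l i * pL_rec hu hl + G * geo u τ l⁻¹ i * pL_rec hu hl'
    · linear_combination -geo u τ l i * qL_rec (w := w) hu hl
        + G * geo u τ l⁻¹ i * qL_rec (w := w) hu hl'

lemma col_right (hu : 0 < u) (hl : 0 < l)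
    (hG : G = l ^ (2 * N) * ((l + u) / (1 + u * l)) ^ 4) {i k : ℕ} (hi : 2 ≤ i) (hk : i + k = N) :
    rightSum u (col u τ l G N) i k = pR u l * geo u τ l i - G * (pR u l⁻¹ * geo u τ l⁻¹ i) ∧
    rightWeighted u w (col u τ l G N) i k
      = qR u w l * geo u τ l i - G * (qR u w l⁻¹ * geo u τ l⁻¹ i) := by
  have hl' := inv_pos.2 hl
  induction k generalizing i with
  | zero =>
    obtain rfl : i = N := by omega
    rw [rightSum_zero, rightWeighted_zero, col_last hi]
    exact ⟨rfl, pR_geo_eq_qR_geo hu hl hG w⟩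
  | succ k ih =>
    obtain ⟨h1, h2⟩ := ih (i := i + 1) (by omega) (by omega)
    rw [rightSum_succ, rightWeighted_succ, h1, h2, col_mid hi (by omega), geo_succ, geo_succ]
    constructor
    · linear_combination -geo u τ l i * pR_rec hu hl + G * geo u τ l⁻¹ i * pR_rec hu hl'
    · linear_combination -geo u τ l i * qR_rec (w := w) hu hl
        + G * geo u τ l⁻¹ i * qR_rec (w := w) hu hl'

theorem row_sum_col (hu : 0 < u) (hl : 0 < l) (hτ : 0 < τ) (h : Param u w l)
    (hτ' : τ = (w - 1) * u + (1 + w) * u ^ 3)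
    (hG : G = l ^ (2 * N) * ((l + u) / (1 + u * l)) ^ 4) (hN : 3 ≤ N) {i : ℕ} (hi : i ≤ N) :
    ∑ j ∈ range (N + 1), (1 + w * (Int.natAbs ((i : ℤ) - j) : ℝ))
        * u ^ Int.natAbs ((i : ℤ) - j) * col u τ l G N j
      = if i = 0 then 1 - G else 0 := by
  have hl' := inv_pos.2 hl
  have h' := h.inv hu hl
  obtain ⟨k, rfl⟩ := Nat.exists_eq_add_of_le hi
  rw [row_sum_eq]
  rcases Nat.lt_or_ge i 2 with hi2 | hi2
  · interval_cases i
    · obtain ⟨k, rfl⟩ : ∃ k', k = k' + 2 := ⟨k - 2, by omega⟩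
      obtain ⟨h1, h2⟩ := col_right (u := u) (τ := τ) (w := w) hu hl hG (i := 2) (k := k) le_rfl
        (by omega)
      rw [leftWeighted_zero, rightWeighted_succ, rightSum_succ, rightWeighted_succ]
      simp only [zero_add, Nat.reduceAdd] at h1 h2 ⊢
      rw [h1, h2, col_zero, col_one, if_pos trivial]
      linear_combination h.row_zero hu hl hτ hτ' - G * h'.row_zero hu hl' hτ hτ'
    · obtain ⟨k, rfl⟩ : ∃ k', k = k' + 1 := ⟨k - 1, by omega⟩
      obtain ⟨h1, h2⟩ := col_right (u := u) (τ := τ) (w := w) hu hl hG (i := 2) (k := k) le_rfl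
        (by omega)
      rw [leftWeighted_succ, leftWeighted_zero, leftSum_zero, rightWeighted_succ]
      simp only [zero_add, Nat.reduceAdd] at h1 h2 ⊢
      rw [h1, h2, col_zero, col_one, if_neg one_ne_zero]
      linear_combination h.row_one (τ := τ) hu hl - G * h'.row_one (τ := τ) hu hl'
  · rw [if_neg (by omega), (col_right (w := w) hu hl hG hi2 rfl).2]
    -- In the last row the non-geometric entry at `N` is counted on both sides and cancels, leaving
    -- the left sums up to `N - 1` and the tail value.
    rcases Nat.eq_zero_or_pos k with rfl | hk
    · obtain ⟨i, rfl⟩ : ∃ i', i = i' + 1 := ⟨i - 1, by omega⟩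
      obtain ⟨h1, h2⟩ := col_left (w := w) (G := G) (N := i + 1 + 0) hu hl hτ (i := i) (by omega)
        (by omega)
      rw [leftWeighted_succ, h1, h2, geo_succ, geo_succ]
      linear_combination -geo u τ l i * qL_rec (w := w) hu hl
        + G * geo u τ l⁻¹ i * qL_rec (w := w) hu hl'
        - l * geo u τ l i * h.qL_add_qR hu hl + G * l⁻¹ * geo u τ l⁻¹ i * h'.qL_add_qR hu hl'
    · rw [(col_left (w := w) hu hl hτ hi2 (by omega)).2, col_mid hi2 (by omega)]
      linear_combination geo u τ l i * h.qL_add_qR hu hl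
        - G * geo u τ l⁻¹ i * h'.qL_add_qR hu hl'

end Column

/-! ### Invertibility and relations between entries of the inverse -/

section Inverse

open Matrix

variable {w l : ℝ} {n : ℕ}

/-- The correlation function at lag `k`. -/
noncomputable def corr (w : ℝ) (k : ℕ) : ℝ := (1 + w * k) * u w ^ k

lemma R_eq_toeplitz (θ : ℝ) (n : ℕ) : R θ n = toeplitz (corr (θ / n)) n := by
  ext i j
  have h : |((i : ℕ) : ℝ) - ((j : ℕ) : ℝ)| = (Int.natAbs (((i : ℕ) : ℤ) - (j : ℕ)) : ℝ) := by
    rw [Nat.cast_natAbs]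
    push_cast
    rfl
  simp only [R, toeplitz, of_apply, corr, u]
  rw [h, ← Real.exp_nat_mul]
  congr 2
  · ring
  · ring

lemma toeplitz_inv_reflect {f : ℕ → ℝ} {i j i' j' : Fin n} (hi : (i : ℕ) + i' + 1 = n)
    (hj : (j : ℕ) + j' + 1 = n) : (toeplitz f n)⁻¹ i j = (toeplitz f n)⁻¹ i' j' := by
  have hi' : i'.rev = i := Fin.ext (by rw [Fin.val_rev]; omega)
  have hj' : j'.rev = j := Fin.ext (by rw [Fin.val_rev]; omega)
  rw [← hi', ← hj', toeplitz_inv_rev]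

/-- The combination of the last three rows that isolates the last two entries of a column of the
inverse. -/
lemma last_two_entries (hn : 3 ≤ n) (hdet : IsUnit (toeplitz (corr w) n).det) {i k : Fin n}
    (hi : (i : ℕ) + 1 = n) (hk : (k : ℕ) + 2 = n) (j : Fin n) :
    tau (-1) w * (toeplitz (corr w) n)⁻¹ k j + tau 0 w * (toeplitz (corr w) n)⁻¹ i j
      = (if i = j then 1 else 0) - 2 * u w * (if k = j then 1 else 0)
        + u w ^ 2 * (if (j : ℕ) + 3 = n then 1 else 0) := by
  set T := toeplitz (corr w) n with hT
  obtain ⟨m, hm⟩ : ∃ m : Fin n, (m : ℕ) + 3 = n := ⟨⟨n - 3, by omega⟩, by simp; omega⟩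
  have hmul : ∀ p : Fin n, ∑ q, T p q * T⁻¹ q j = if p = j then 1 else 0 := fun p => by
    rw [← mul_apply, mul_nonsing_inv T hdet, one_apply]
  have hmj : (if (j : ℕ) + 3 = n then (1 : ℝ) else 0) = if m = j then 1 else 0 :=
    if_congr (by rw [Fin.ext_iff]; omega) rfl rfl
  have hik : i ≠ k := fun h => by rw [h] at hi; omega
  -- The coefficients `1, -2u, u²` annihilate `(1 + w d) u^d`, whose double root is `u`. Only the
  -- last two columns, where the absolute value in the lag interferes, survive.
  have hrow : ∀ q, T i q - 2 * u w * T k q + u w ^ 2 * T m q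
      = (if q = k then tau (-1) w else 0) + if q = i then tau 0 w else 0 := fun q => by
    simp only [hT, toeplitz, of_apply]
    rcases Nat.lt_or_ge ((q : ℕ) + 2) n with hq | hq
    · obtain ⟨d, hd⟩ : ∃ d, (q : ℕ) + d = m := ⟨m - q, by omega⟩
      rw [if_neg (fun h => by rw [h] at hq; omega), if_neg (fun h => by rw [h] at hq; omega),
        show Int.natAbs ((i : ℤ) - (q : ℕ)) = d + 2 by omega,
        show Int.natAbs ((k : ℤ) - (q : ℕ)) = d + 1 by omega,
        show Int.natAbs ((m : ℤ) - (q : ℕ)) = d by omega]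
      simp only [corr]
      push_cast
      ring
    · rcases Nat.eq_or_lt_of_le hq with hq | hq
      · obtain rfl : q = k := Fin.ext (by omega)
        rw [if_pos rfl, if_neg (Ne.symm hik),
          show Int.natAbs ((i : ℤ) - (q : ℕ)) = 1 by omega,
          show Int.natAbs ((q : ℤ) - (q : ℕ)) = 0 by omega,
          show Int.natAbs ((m : ℤ) - (q : ℕ)) = 1 by omega, tau_neg_one_eq]
        simp only [corr]
        push_cast
        ring
      · obtain rfl : q = i := Fin.ext (by omega)
        rw [if_pos rfl, if_neg hik,
          show Int.natAbs ((q : ℤ) - (q : ℕ)) = 0 by omega,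
          show Int.natAbs ((k : ℤ) - (q : ℕ)) = 1 by omega,
          show Int.natAbs ((m : ℤ) - (q : ℕ)) = 2 by omega, tau_zero_eq]
        simp only [corr]
        push_cast
        ring
  rw [hmj, ← hmul i, ← hmul k, ← hmul m, Finset.mul_sum, Finset.mul_sum,
    ← Finset.sum_sub_distrib, ← Finset.sum_add_distrib]
  have hsum : ∀ q, T i q * T⁻¹ q j - 2 * u w * (T k q * T⁻¹ q j) + u w ^ 2 * (T m q * T⁻¹ q j)
      = (if q = k then tau (-1) w * T⁻¹ q j else 0)
        + if q = i then tau 0 w * T⁻¹ q j else 0 := fun q => by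
    have := hrow q
    split_ifs at this ⊢ <;> linear_combination T⁻¹ q j * this
  simp only [hsum, Finset.sum_add_distrib, Finset.sum_ite_eq', Finset.mem_univ, if_true]

/-- The ratio of the contributions of the growing and the decaying solutions. -/
noncomputable def growth (u l : ℝ) (N : ℕ) : ℝ := l ^ (2 * N) * ((l + u) / (1 + u * l)) ^ 4

lemma growth_nonneg {u : ℝ} (hu : 0 < u) (hl : 0 < l) (N : ℕ) : 0 ≤ growth u l N := by
  rw [growth]
  positivity

lemma growth_le {u : ℝ} (hu : 0 < u) (hu1 : u < 1) (hl : 0 < l) (hl1 : l < 1) (N : ℕ) :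
    growth u l N ≤ l ^ (2 * N) := by
  rw [growth]
  refine mul_le_of_le_one_right (by positivity) (pow_le_one₀ (by positivity) ?_)
  rw [div_le_one (by positivity)]
  nlinarith

/-- The matrix is invertible, and its inverse has the explicit first column. -/
theorem inv_first_col (hw : 0 < w) (hl : 0 < l) (hl1 : l < 1) (h : Param (u w) w l)
    (hn : 4 ≤ n) :
    IsUnit (toeplitz (corr w) n).det ∧ ∀ i j : Fin n, (j : ℕ) = 0 →
      (toeplitz (corr w) n)⁻¹ i j * (1 - growth (u w) l (n - 1))
        = col (u w) (tau (-1) w) l (growth (u w) l (n - 1)) (n - 1) i := by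
  obtain ⟨N, rfl⟩ : ∃ N, n = N + 1 := ⟨n - 1, by omega⟩
  rw [Nat.add_sub_cancel]
  have hu := u_pos w
  have hτ := tau_neg_one_pos hl h hw
  set G := growth (u w) l N with hG
  have hGN : G ≤ l ^ (2 * N) := growth_le hu (u_lt_one hw) hl hl1 N
  -- The first entry is proportional to `l² - G`, so this is the nonvanishing needed for
  -- invertibility.
  have hG2 : G < l ^ 2 :=
    hGN.trans_lt (pow_lt_pow_right_of_lt_one₀ hl hl1 (by omega))
  have hG1 : 0 < 1 - G := by nlinarith
  set x : Fin (N + 1) → ℝ := fun j => col (u w) (tau (-1) w) l G N j / (1 - G) with hx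
  have hmul : toeplitz (corr w) (N + 1) *ᵥ x = Pi.single 0 1 := by
    ext i
    have hrow := row_sum_col hu hl hτ h (tau_neg_one_eq w) hG (by omega)
      (Nat.lt_succ_iff.1 i.2)
    rw [← Fin.sum_univ_eq_sum_range (fun j => (1 + w * (Int.natAbs (((i : ℕ) : ℤ) - j) : ℝ))
        * u w ^ Int.natAbs (((i : ℕ) : ℤ) - j) * col (u w) (tau (-1) w) l G N j)] at hrow
    simp only [mulVec, dotProduct, toeplitz, of_apply, corr, hx, mul_div_assoc']
    rw [← Finset.sum_div, hrow, Pi.single_apply]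
    by_cases hi : i = 0
    · simp [hi, hG1.ne']
    · have hi' : (i : ℕ) ≠ 0 := fun e => hi (Fin.ext e)
      simp [hi, hi']
  have hx0 : x 0 ≠ 0 := by
    have e : x 0 = (l ^ 2 - G) / (l * tau (-1) w * (1 - G)) := by
      simp only [hx, Fin.val_zero, col_zero]
      field_simp
    rw [e]
    have : 0 < l ^ 2 - G := by linarith
    positivity
  have hdet := isUnit_det_toeplitz hmul hx0
  refine ⟨hdet, fun i j hj => ?_⟩
  obtain rfl : j = 0 := Fin.ext hj
  rw [inv_col_eq hdet hmul i]
  simp only [hx]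
  field_simp

end Inverse

/-! ### Error bounds and identification of the main terms -/

section Entries

variable {w l G : ℝ} {n : ℕ}

/-- The error is `G (1 - Q) / (1 - G)`, with `Q` the ratio of the dropped `l⁻¹` part to the kept
part; `25 · 1875 / (3/4) = 62500` fits under the constant. -/
lemma relErr_of_mul_eq {x y Q r : ℝ} (hG : 0 ≤ G) (hG' : G ≤ 1 / 4) (hGr : G ≤ 25 * r)
    (hQ : 0 ≤ Q) (hQ' : Q ≤ 1875) (h : x * (1 - G) = y * (1 - G * Q)) :
    RelErr x y (100000 * r) := by
  have hG1 : 0 < 1 - G := by linarith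
  refine ⟨G * (1 - Q) / (1 - G), ?_, ?_⟩
  · rw [abs_div, abs_mul, abs_of_nonneg hG, abs_of_pos hG1, div_le_iff₀ hG1]
    have h1 : |1 - Q| ≤ 1875 := abs_le.2 ⟨by linarith, by linarith⟩
    have h2 : G * |1 - Q| ≤ 25 * r * 1875 :=
      mul_le_mul hGr h1 (abs_nonneg _) (by linarith)
    nlinarith
  · field_simp
    linear_combination h

lemma two_sub_sqrt_three_le : 2 - √3 ≤ 1 / 2 := by
  have : (3 / 2 : ℝ) ≤ √3 := Real.le_sqrt_of_sq_le (by norm_num)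
  linarith

lemma one_div_le_sq (hl : 1 / 5 ≤ l) : 1 / 25 ≤ l ^ 2 := by nlinarith

lemma growth_bounds {u : ℝ} (hu : 0 < u) (hu1 : u < 1) (hl5 : 1 / 5 ≤ l) (hl3 : l ≤ 2 - √3)
    (hn : 2 ≤ n) :
    growth u l (n - 1) ≤ 1 / 4 ∧ growth u l (n - 1) ≤ 25 * ((2 - √3) / (2 + √3)) ^ n := by
  have hl : 0 < l := by linarith
  have hl2 : l ≤ 1 / 2 := hl3.trans two_sub_sqrt_three_le
  have hGl : growth u l (n - 1) ≤ l ^ (2 * (n - 1)) := growth_le hu hu1 hl (by linarith) _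
  constructor
  · have h1 : l ^ (2 * (n - 1)) ≤ l ^ 2 :=
      pow_le_pow_of_le_one hl.le (by linarith) (by omega)
    nlinarith
  -- The factor 25 pays for the missing `l²` in `l^(2(n-1))`.
  · have hr : (2 - √3) / (2 + √3) = (2 - √3) ^ 2 := by
      have h3 : √3 ^ 2 = 3 := Real.sq_sqrt (by norm_num)
      have : 0 < 2 + √3 := by positivity
      rw [div_eq_iff this.ne']
      linear_combination (2 - √3) * h3
    have h1 : l ^ (2 * (n - 1)) * l ^ 2 = (l ^ 2) ^ n := by
      rw [← pow_add, ← pow_mul]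
      congr 1
      omega
    have h2 : (l ^ 2) ^ n ≤ ((2 - √3) ^ 2) ^ n := by gcongr
    have h3 : 0 ≤ l ^ (2 * (n - 1)) := by positivity
    have h4 := mul_le_mul_of_nonneg_left (one_div_le_sq hl5) h3
    rw [hr]
    linarith

/-- The numerator is at most 3 and the denominator at least `l⁴ ≥ 1/625`. -/
lemma second_ratio_le {u : ℝ} (hu : 0 < u) (hu1 : u < 1) (hl5 : 1 / 5 ≤ l) (hl1 : l ≤ 1) :
    (2 * u * l + 1) / (l ^ 3 * (2 * u + l)) ≤ 1875 := by
  have hl : 0 < l := by linarith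
  have h4 : (1 / 25 : ℝ) ^ 2 ≤ (l ^ 2) ^ 2 :=
    pow_le_pow_left₀ (by norm_num) (one_div_le_sq hl5) 2
  have h5 : u * l ≤ 1 := mul_le_one₀ hu1.le hl.le hl1
  have h6 : 0 ≤ l ^ 3 * u := by positivity
  rw [div_le_iff₀ (by positivity)]
  linarith

/-- Explains `γ₂/γ₁` in the theorem: up to powers of `l²` it is `G`. -/
lemma gam_inv_eq (hl : 0 < l) (h : Param (u w) w l) :
    gam w (-(u w / l⁻¹))
      = gam w (-(u w / l)) * (l ^ 2 * ((l + u w) / (1 + u w * l)) ^ 4) := by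
  have hu := u_pos w
  rw [gam_eq hl h, gam_eq (inv_pos.2 hl) (h.inv hu hl)]
  field_simp
  ring

lemma gam_ne_zero (hw : 0 < w) (hl : 0 < l) (h : Param (u w) w l) : gam w (-(u w / l)) ≠ 0 := by
  have h1 := u_pos w
  have h2 := u_lt_one hw
  have h3 : 0 < 1 - u w ^ 2 := by nlinarith
  rw [gam_eq hl h, neg_ne_zero]
  positivity

/-- The corner entry of the first column. -/
lemma col_last_eq (hw : 0 < w) (hl : 0 < l) (h : Param (u w) w l) (k : ℕ) :
    col (u w) (tau (-1) w) l (growth (u w) l (k + 2)) (k + 2) (k + 2)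
      = (-1) ^ k * (w ^ 2 * u w ^ 2 * (-(u w / l) - -(u w / l⁻¹))
          / (tau (-1) w * gam w (-(u w / l)))) * l ^ (k + 1) := by
  have hu := u_pos w
  have hu1 : 0 < 1 - u w ^ 2 := by nlinarith [u_lt_one hw]
  have hτ := tau_neg_one_pos hl h hw
  have e : w ^ 2 * u w ^ 2 * (-(u w / l) - -(u w / l⁻¹)) / gam w (-(u w / l))
      = (1 - l ^ 2) * (l + u w) ^ 2 / (1 + u w * l) ^ 2 := by
    rw [gam_eq hl h]
    have hP := h
    unfold Param at hP
    generalize u w = v at hP hu hu1 ⊢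
    rw [hP]
    field_simp
    ring
  -- At the far end `G` brings the growing solution down to the size of the decaying one, so both
  -- contribute to the corner.
  have e1 : growth (u w) l (k + 2) * (-l⁻¹) ^ (k + 2)
      = (-l) ^ (k + 2) * ((l + u w) / (1 + u w * l)) ^ 4 := by
    have : l ^ (2 * (k + 2)) * (-l⁻¹) ^ (k + 2) = (-l) ^ (k + 2) := by
      rw [pow_mul, ← mul_pow]
      congr 1
      field_simp
    rw [growth]
    linear_combination ((l + u w) / (1 + u w * l)) ^ 4 * this
  have e2 : pR (u w) l * ((l + u w) ^ 2 / (l * tau (-1) w))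
      - pR (u w) l⁻¹ * ((l⁻¹ + u w) ^ 2 / (l⁻¹ * tau (-1) w)) * ((l + u w) / (1 + u w * l)) ^ 4
      = (1 - l ^ 2) * (l + u w) ^ 2 / (1 + u w * l) ^ 2 / (tau (-1) w * l) := by
    rw [pR, pR]
    field_simp
    ring
  rw [div_mul_eq_div_div_swap, e, col_last (by omega), geo, geo]
  calc _ = (-l) ^ (k + 2) * (pR (u w) l * ((l + u w) ^ 2 / (l * tau (-1) w))
        - pR (u w) l⁻¹ * ((l⁻¹ + u w) ^ 2 / (l⁻¹ * tau (-1) w))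
          * ((l + u w) / (1 + u w * l)) ^ 4) := by
        linear_combination
          -(pR (u w) l⁻¹ * ((l⁻¹ + u w) ^ 2 / (l⁻¹ * tau (-1) w))) * e1
    _ = _ := by
        rw [e2, neg_pow l, pow_add (-1 : ℝ) k 2]
        field_simp
        ring

/-- The coefficient of a geometric solution in the middle of the first column. -/
lemma C6_mul_eq (hw : 0 < w) (hl : 0 < l) (h : Param (u w) w l) (p q : ℕ) :
    C6 w (-(u w / l)) * tau (-1) w ^ q * rho w (-(u w / l)) ^ p
        / rho w (-(u w / l)) ^ (p + q + 3)
      = (-1) ^ q * geo (u w) (tau (-1) w) l (q + 2) := by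
  have hτ := tau_neg_one_pos hl h hw
  have hs : (-1 : ℝ) ^ q * (-1) ^ q = 1 := by rw [← mul_pow]; norm_num
  rw [C6_eq hl h hw, rho_eq, geo, neg_pow l, pow_add _ (p + q), pow_add _ p, div_pow, div_pow,
    pow_add (-1 : ℝ) q 2]
  field_simp
  linear_combination -(l ^ (q + 2) * (l + u w) ^ 2) * hs

lemma rho_inv_eq (hl : 0 < l) : rho w (-(u w / l⁻¹)) = rho w (-(u w / l)) * l ^ 2 := by
  rw [rho_eq, rho_eq]
  field_simp

lemma growth_eq_gam (hw : 0 < w) (hl : 0 < l) (h : Param (u w) w l) (k : ℕ) :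
    growth (u w) l (k + 1) = gam w (-(u w / l⁻¹)) / gam w (-(u w / l)) * (l ^ 2) ^ k := by
  rw [gam_inv_eq hl h, growth, mul_div_assoc, mul_comm (gam _ _),
    div_mul_cancel₀ _ (gam_ne_zero hw hl h)]
  ring

end Entries

end MaternInverse

/-! ### Assembly of the entries -/

theorem theorem6 (β₀ β₁ : ℝ) (hβ₀ : 0 < β₀) (hβ : β₀ < β₁) :
    ∃ (C : ℝ) (N : ℕ), ∀ (n : ℕ) (hn : 5 ≤ n), N ≤ n → ∀ θ ∈ Set.Icc β₀ β₁,
      ∀ w α₁ α₂ ε : ℝ, w = θ / n → α₁ = alpha1 w → α₂ = alpha2 w →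
      ε = C * ((2 - √3) / (2 + √3)) ^ n →
      IsUnit (R θ n).det ∧
      RelErr ((R θ n)⁻¹ (idx n 2 (by omega)) (idx n (n - 1) (by omega)))
        ((-1) ^ (n - 3) * (tau 0 w * kap w * (α₁ - α₂) / (tau (-1) w ^ 3 * gam w α₁))
          * (-(u w / α₁)) ^ (n - 2)) ε ∧
      RelErr ((R θ n)⁻¹ (idx n (n - 1) (by omega)) (idx n (n - 1) (by omega)))
        (C7 w α₁ / rho w α₁ ^ 2
          - C7 w α₂ * gam w α₂ / (gam w α₁ * rho w α₁ ^ 2) * (α₂ / α₁) ^ (n - 4)) ε ∧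
      RelErr ((R θ n)⁻¹ (idx n 1 (by omega)) (idx n n (by omega)))
        ((-1) ^ (n + 1) * (w ^ 2 * u w ^ 2 * (α₁ - α₂) / (tau (-1) w * gam w α₁))
          * (-(u w / α₁)) ^ (n - 2)) ε ∧
      RelErr ((R θ n)⁻¹ (idx n 2 (by omega)) (idx n n (by omega)))
        ((-1) ^ (n + 2) * (kap w * (α₁ - α₂) / (tau (-1) w ^ 2 * gam w α₁))
          * (-(u w / α₁)) ^ (n - 2)) ε ∧
      (∀ (i : ℕ) (hi : 3 ≤ i ∧ i ≤ n - 2), ∃ e₁ e₂ : ℝ, |e₁| ≤ ε ∧ |e₂| ≤ ε ∧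
        (R θ n)⁻¹ (idx n i (by omega)) (idx n n (by omega)) =
          (-1) ^ (n + i) * C6 w α₁ * tau (-1) w ^ (n - i - 2) * rho w α₁ ^ (i - 3)
              / rho w α₁ ^ (n - 2) * (1 + e₁)
            - (-1) ^ (n + i) * C6 w α₂ * tau (-1) w ^ (n - i - 2) * gam w α₂
              * rho w α₂ ^ (i - 3) / (gam w α₁ * rho w α₁ ^ (n - 2)) * (1 + e₂)) ∧
      RelErr ((R θ n)⁻¹ (idx n (n - 1) (by omega)) (idx n n (by omega)))
        (-(C3 w α₁ / rho w α₁ ^ 2)) ε ∧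
      RelErr ((R θ n)⁻¹ (idx n n (by omega)) (idx n n (by omega)))
        (-(1 / ((b w + tau (-1) w * u w) * α₁))) ε ∧
      RelErr ((R θ n)⁻¹ (idx n 1 (by omega)) (idx n 1 (by omega)))
        (-(1 / ((b w + tau (-1) w * u w) * α₁))) ε ∧
      RelErr ((R θ n)⁻¹ (idx n 2 (by omega)) (idx n 1 (by omega)))
        (-(C3 w α₁ / rho w α₁ ^ 2)) ε ∧
      (∀ (i : ℕ) (hi : 3 ≤ i ∧ i ≤ n - 2), ∃ e₁ e₂ : ℝ, |e₁| ≤ ε ∧ |e₂| ≤ ε ∧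
        (R θ n)⁻¹ (idx n i (by omega)) (idx n 1 (by omega)) =
          (-1) ^ (i + 1) * C6 w α₁ * tau (-1) w ^ (i - 3) * rho w α₁ ^ (n - i - 2)
              / rho w α₁ ^ (n - 2) * (1 + e₁)
            - (-1) ^ (i + 1) * C6 w α₂ * tau (-1) w ^ (i - 3) * gam w α₂
              * rho w α₂ ^ (n - i - 2) / (gam w α₁ * rho w α₁ ^ (n - 2)) * (1 + e₂)) ∧
      RelErr ((R θ n)⁻¹ (idx n (n - 1) (by omega)) (idx n 1 (by omega)))
        ((-1) ^ (n + 2) * (kap w * (α₁ - α₂) / (tau (-1) w ^ 2 * gam w α₁))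
          * (-(u w / α₁)) ^ (n - 2)) ε := by

  -- The threshold ensures `w ≤ 1/2`, as `exists_root` requires.
  refine ⟨100000, ⌈2 * β₁⌉₊, ?_⟩
  intro n hn hN θ hθ w α₁ α₂ ε hw hα₁ hα₂ hε
  have hβ₁ : 0 < β₁ := hβ₀.trans hβ
  have hn0 : (0 : ℝ) < n := by exact_mod_cast (by omega : 0 < n)
  have hw0 : 0 < w := by rw [hw]; exact div_pos (hβ₀.trans_le hθ.1) hn0
  have hw1 : w ≤ 1 / 2 := by
    rw [hw, div_le_iff₀ hn0]
    have h1 : 2 * β₁ ≤ n := (Nat.le_ceil _).trans (by exact_mod_cast hN)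
    linarith [hθ.2]
  obtain ⟨l, hl5, hl3, hP, ha1, ha2⟩ := exists_root hw0 hw1
  rw [ha1] at hα₁
  rw [ha2] at hα₂
  have hl : 0 < l := by linarith
  have hl' := inv_pos.2 hl
  have hu := u_pos w
  have hu1 := u_lt_one hw0
  have hP' := hP.inv hu hl
  have hl2 : l ≤ 1 / 2 := hl3.trans two_sub_sqrt_three_le
  have hτ := tau_neg_one_pos hl hP hw0
  obtain ⟨hdet, hcol⟩ := inv_first_col hw0 hl (by linarith) hP (by omega : 4 ≤ n)
  set G := growth (u w) l (n - 1) with hGdef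
  have hG0 : 0 ≤ G := growth_nonneg hu hl _
  obtain ⟨hG4, hGr⟩ := growth_bounds hu hu1 hl5 hl3 (by omega : 2 ≤ n)
  rw [← hGdef] at hG4 hGr
  rw [hε]
  have hrel : ∀ {x y : ℝ}, x * (1 - G) = y →
      RelErr x y (100000 * ((2 - √3) / (2 + √3)) ^ n) := fun {x y} h =>
    relErr_of_mul_eq hG0 hG4 hGr le_rfl (by norm_num) (by rw [h]; ring)
  have hG1 : 0 < 1 - G := by linarith
  have herr : |G / (1 - G)| ≤ 100000 * ((2 - √3) / (2 + √3)) ^ n := by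
    obtain ⟨e, he, h1⟩ := hrel (x := 1 / (1 - G)) (y := 1) (by field_simp)
    have : e = G / (1 - G) := by
      field_simp at h1 ⊢
      linarith
    rwa [← this]
  rw [R_eq_toeplitz, ← hw]
  set B := (toeplitz (corr w) n)⁻¹ with hB
  have hrefl : ∀ {i j i' j' : Fin n}, (i : ℕ) + i' + 1 = n → (j : ℕ) + j' + 1 = n →
      B i j = B i' j' := fun hi hj => toeplitz_inv_reflect hi hj
  have hsymm : ∀ i j, B i j = B j i := toeplitz_inv_symm _ _
  have hlast := last_two_entries (w := w) (by omega) hdet (i := idx n n (by omega))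
    (k := idx n (n - 1) (by omega)) (by simp only [idx]; omega) (by simp only [idx]; omega)
  rw [← hB] at hlast
  have hua : -(u w / α₁) = l := by
    rw [hα₁]
    field_simp
  have hcorner : B (idx n n (by omega)) (idx n 1 (by omega)) * (1 - G)
      = (-1) ^ (n + 1) * (w ^ 2 * u w ^ 2 * (α₁ - α₂) / (tau (-1) w * gam w α₁))
          * (-(u w / α₁)) ^ (n - 2) := by
    rw [hua, hcol _ _ (by simp [idx]), hα₁, hα₂]
    obtain ⟨k, rfl⟩ : ∃ k, n = k + 3 := ⟨n - 3, by omega⟩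
    have := col_last_eq hw0 hl hP k
    simp only [idx, hGdef, show k + 3 - 1 = k + 2 by omega,
      show k + 3 - 2 = k + 1 by omega]
    rw [this, show k + 3 + 1 = k + 4 by ring, pow_add (-1 : ℝ) k 4]
    ring
  have hpen : B (idx n (n - 1) (by omega)) (idx n 1 (by omega)) * (1 - G)
      = (-1) ^ (n + 2) * (kap w * (α₁ - α₂) / (tau (-1) w ^ 2 * gam w α₁))
          * (-(u w / α₁)) ^ (n - 2) := by
    have h1 := hlast (idx n 1 (by omega))
    rw [if_neg (by rw [Fin.ext_iff]; simp only [idx]; omega),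
      if_neg (by rw [Fin.ext_iff]; simp only [idx]; omega),
      if_neg (by simp only [idx]; omega)] at h1
    have h2 : B (idx n (n - 1) (by omega)) (idx n 1 (by omega))
        = -(tau 0 w / tau (-1) w) * B (idx n n (by omega)) (idx n 1 (by omega)) := by
      field_simp
      linear_combination h1
    rw [h2, mul_assoc, hcorner, kap_eq, pow_add (-1 : ℝ) n 2, pow_add (-1 : ℝ) n 1]
    ring
  have hzero : B (idx n 1 (by omega)) (idx n 1 (by omega)) * (1 - G)
      = l / tau (-1) w - G * (l⁻¹ / tau (-1) w) := by
    rw [hcol _ _ (by simp [idx])]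
    exact col_zero
  have hone : B (idx n 2 (by omega)) (idx n 1 (by omega)) * (1 - G)
      = -(l * (2 * u w + l) / tau (-1) w) - G * -(l⁻¹ * (2 * u w + l⁻¹) / tau (-1) w) := by
    rw [hcol _ _ (by simp [idx])]
    exact col_one
  have hfirst : RelErr (B (idx n 1 (by omega)) (idx n 1 (by omega)))
      (-(1 / ((b w + tau (-1) w * u w) * α₁))) (100000 * ((2 - √3) / (2 + √3)) ^ n) := by
    refine relErr_of_mul_eq (Q := (l ^ 2)⁻¹) hG0 hG4 hGr (by positivity) ?_ ?_
    · have := inv_anti₀ (by norm_num) (one_div_le_sq hl5)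
      linarith
    · rw [hzero, b_add_eq, hα₁]
      field_simp
  have hsecond : RelErr (B (idx n 2 (by omega)) (idx n 1 (by omega)))
      (-(C3 w α₁ / rho w α₁ ^ 2)) (100000 * ((2 - √3) / (2 + √3)) ^ n) := by
    refine relErr_of_mul_eq (Q := (2 * u w * l + 1) / (l ^ 3 * (2 * u w + l)))
      hG0 hG4 hGr (by positivity) ?_ ?_
    · exact second_ratio_le hu hu1 hl5 (by linarith)
    · rw [hone, hα₁, C3_eq hl hP hw0, rho_eq]
      field_simp
      ring
  -- Both modes carry the same exact factor `1/(1 - G) = 1 + G/(1 - G)`, so the two errors coincide.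
  have hmid : ∀ p q : ℕ, p + q + 5 = n → ∀ i : Fin n, (i : ℕ) = q + 2 →
      ∃ e₁ e₂ : ℝ, |e₁| ≤ 100000 * ((2 - √3) / (2 + √3)) ^ n ∧
        |e₂| ≤ 100000 * ((2 - √3) / (2 + √3)) ^ n ∧
        B i (idx n 1 (by omega)) =
          (-1) ^ q * C6 w α₁ * tau (-1) w ^ q * rho w α₁ ^ p / rho w α₁ ^ (n - 2) * (1 + e₁)
            - (-1) ^ q * C6 w α₂ * tau (-1) w ^ q * gam w α₂ * rho w α₂ ^ p
              / (gam w α₁ * rho w α₁ ^ (n - 2)) * (1 + e₂) := by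
    intro p q hpq i hi
    refine ⟨G / (1 - G), G / (1 - G), herr, herr, ?_⟩
    have hx := hcol i (idx n 1 (by omega)) (by simp [idx])
    rw [hi, col_mid (by omega) (by omega)] at hx
    have k1 := C6_mul_eq hw0 hl hP p q
    have k2 := C6_mul_eq hw0 hl' hP' p q
    have hs : (-1 : ℝ) ^ q * (-1) ^ q = 1 := by rw [← mul_pow]; norm_num
    have hGγ := growth_eq_gam hw0 hl hP (p + q + 3)
    rw [show p + q + 3 + 1 = n - 1 by omega, ← hGdef] at hGγ
    have hρ := rho_inv_eq (w := w) hl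
    have hγ0 := gam_ne_zero hw0 hl hP
    have hρ0 : rho w (-(u w / l)) ≠ 0 := by
      rw [rho_eq]
      positivity
    rw [← hα₁] at k1 hGγ hρ hγ0 hρ0
    rw [← hα₂] at k2 hGγ hρ
    rw [show n - 2 = p + q + 3 by omega]
    have k2' : C6 w α₂ * tau (-1) w ^ q * gam w α₂ * rho w α₂ ^ p
        / (gam w α₁ * rho w α₁ ^ (p + q + 3))
        = G * ((-1) ^ q * geo (u w) (tau (-1) w) l⁻¹ (q + 2)) := by
      rw [← k2, hGγ, hρ]
      field_simp
      ring
    have e1 : 1 + G / (1 - G) = 1 / (1 - G) := by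
      field_simp
      ring
    have e2 : B i (idx n 1 (by omega)) = (geo (u w) (tau (-1) w) l (q + 2)
        - G * geo (u w) (tau (-1) w) l⁻¹ (q + 2)) * (1 / (1 - G)) := by
      rw [← hx]
      field_simp
    rw [e1, e2]
    linear_combination (-1) ^ q * (1 / (1 - G)) * (k2' - k1)
      - (geo (u w) (tau (-1) w) l (q + 2) * (1 / (1 - G))
        - G * geo (u w) (tau (-1) w) l⁻¹ (q + 2) * (1 / (1 - G))) * hs
  refine ⟨hdet, ?_, ?_, ?_, ?_, ?_, ?_, ?_, hfirst, hsecond, ?_, hrel hpen⟩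
  · apply hrel
    -- The row relation is used a second time, in column 2, whose last entry equals the entry `(n-1,
    -- 1)` by symmetry and reflection.
    have h1 := hlast (idx n 2 (by omega))
    rw [if_neg (by rw [Fin.ext_iff]; simp only [idx]; omega),
      if_neg (by rw [Fin.ext_iff]; simp only [idx]; omega),
      if_neg (by simp only [idx]; omega)] at h1
    have h2 : B (idx n n (by omega)) (idx n 2 (by omega))
        = B (idx n (n - 1) (by omega)) (idx n 1 (by omega)) := by
      rw [hsymm]
      exact hrefl (by simp only [idx]; omega) (by simp only [idx]; omega)
    have h3 : B (idx n 2 (by omega)) (idx n (n - 1) (by omega))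
        = -(tau 0 w / tau (-1) w) * B (idx n (n - 1) (by omega)) (idx n 1 (by omega)) := by
      rw [hsymm, ← h2]
      field_simp
      linear_combination h1
    obtain ⟨k, rfl⟩ : ∃ k, n = k + 3 := ⟨n - 3, by omega⟩
    rw [h3, mul_assoc, hpen, Nat.add_sub_cancel, show k + 3 + 2 = k + 5 by ring,
      pow_add (-1 : ℝ) k 5]
    ring
  · apply hrel
    have h1 := hlast (idx n (n - 1) (by omega))
    rw [if_neg (by rw [Fin.ext_iff]; simp only [idx]; omega), if_pos rfl,
      if_neg (by simp only [idx]; omega)] at h1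
    have h2 : B (idx n n (by omega)) (idx n (n - 1) (by omega))
        = B (idx n 2 (by omega)) (idx n 1 (by omega)) := by
      rw [hsymm]
      exact hrefl (by simp only [idx]; omega) (by simp only [idx]; omega)
    rw [h2] at h1
    have hGγ := growth_eq_gam hw0 hl hP (n - 4 + 2)
    rw [show n - 4 + 2 + 1 = n - 1 by omega, ← hGdef] at hGγ
    have hγ0 := gam_ne_zero hw0 hl hP
    -- The row relation in column `n-1` has right side `-2u`. After multiplication by `1 - G` this
    -- constant splits between the two modes, and each share is absorbed in a `C₇`.
    have k1 : C7 w α₁ / rho w α₁ ^ 2 = -(2 * u w / tau (-1) w)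
        - tau 0 w / tau (-1) w * -(l * (2 * u w + l) / tau (-1) w) := by
      rw [hα₁, C7_eq hl hP hw0, rho_eq, tau_zero_eq_mul hl hP]
      field_simp
      ring
    have k2 : C7 w α₂ / rho w α₂ ^ 2 = -(2 * u w / tau (-1) w)
        - tau 0 w / tau (-1) w * -(l⁻¹ * (2 * u w + l⁻¹) / tau (-1) w) := by
      rw [hα₂, C7_eq hl' hP' hw0, rho_eq, tau_zero_eq_mul hl' hP']
      field_simp
      ring
    have k3 : C7 w α₂ * gam w α₂ / (gam w α₁ * rho w α₁ ^ 2) * (α₂ / α₁) ^ (n - 4)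
        = G * (C7 w α₂ / rho w α₂ ^ 2) := by
      have e : α₂ / α₁ = l ^ 2 := by
        rw [hα₁, hα₂]
        field_simp
      rw [e, hGγ, hα₁, hα₂, rho_inv_eq hl, pow_add _ (n - 4) 2]
      have hρ0 : rho w (-(u w / l)) ≠ 0 := by
        rw [rho_eq]
        positivity
      field_simp
    rw [k3, k1, k2]
    have h3 : B (idx n (n - 1) (by omega)) (idx n (n - 1) (by omega))
        = -(2 * u w / tau (-1) w)
          - tau 0 w / tau (-1) w * B (idx n 2 (by omega)) (idx n 1 (by omega)) := by
      field_simp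
      linear_combination h1
    rw [h3]
    linear_combination -(tau 0 w / tau (-1) w) * hone
  · apply hrel
    rw [hsymm]
    exact hcorner
  · apply hrel
    rw [← hpen]
    congr 1
    exact hrefl (by simp only [idx]; omega) (by simp only [idx]; omega)
  · intro i hi
    -- Reflection sends row `i` of the last column to row `n + 1 - i` of the first, which is `n - i`
    -- when counted from 0.
    obtain ⟨e₁, e₂, he₁, he₂, h⟩ := hmid (i - 3) (n - i - 2) (by omega) ⟨n - i, by omega⟩
      (by simp only; omega)
    refine ⟨e₁, e₂, he₁, he₂, ?_⟩
    have hs : (-1 : ℝ) ^ (n + i) = (-1) ^ (n - i - 2) := by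
      rw [show n + i = n - i - 2 + 2 * (i + 1) by omega, pow_add, pow_mul (-1 : ℝ) 2]
      norm_num
    rw [hs, ← h]
    exact hrefl (by simp only [idx]; omega) (by simp only [idx]; omega)
  · have e : B (idx n (n - 1) (by omega)) (idx n n (by omega))
        = B (idx n 2 (by omega)) (idx n 1 (by omega)) :=
      hrefl (by simp only [idx]; omega) (by simp only [idx]; omega)
    rw [e]
    exact hsecond
  · have e : B (idx n n (by omega)) (idx n n (by omega))
        = B (idx n 1 (by omega)) (idx n 1 (by omega)) :=
      hrefl (by simp only [idx]; omega) (by simp only [idx]; omega)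
    rw [e]
    exact hfirst
  · intro i hi
    obtain ⟨e₁, e₂, he₁, he₂, h⟩ := hmid (n - i - 2) (i - 3) (by omega) (idx n i (by omega))
      (by simp only [idx]; omega)
    refine ⟨e₁, e₂, he₁, he₂, ?_⟩
    have hs : (-1 : ℝ) ^ (i + 1) = (-1) ^ (i - 3) := by
      rw [show i + 1 = i - 3 + 2 * 2 by omega, pow_add, pow_mul (-1 : ℝ) 2]
      norm_num
    rw [hs]
    exact h
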